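/- Let $g:\mathbb R^n\times\mathbb R^m\to\mathbb R$ and $G=(g_1,\dots,g_s):\mathbb R^n\times\mathbb R^m\to\mathbb R^s$ be $C^2$, with $g(x,\cdot)$ and every $g_i(x,\cdot)$ convex for each $x\in\mathbb R^n$. Let $h:\mathbb R^s\to[-\infty,\infty]$ be proper, epi-polyhedral (its epigraph is a polyhedral set) and nondecreasing with respect to the component-wise order. Write $h^*$ for the conjugate of $h$ and $e_\alpha h(z)=\inf_w\{h(w)+\frac1{2\alpha}|w-z|^2\}$ for its Moreau envelope. For $\alpha,\beta>0$ and $x\in\mathbb R^n$ let $S_{\alpha,\beta}(x)$ be the set of all $(y,p)\in\mathbb R^m\times\mathbb R^s$ such that $$0=-\nabla_y g(x,y)-\nabla_yG(x,y)^\top p-\beta y,\qquad G(x,y)-\alpha p\in\partial h^*(p).$$ **Theorem.** Let $\alpha,\beta>0$. Then $S_{\alpha,\beta}$ is single-valued on $\mathbb R^n$; writing $S_{\alpha,\beta}(x)=(y(x),p(x))$, the point $y(x)$ is the unique minimizer of $y\mapsto g(x,y)+e_\alpha h(G(x,y))+\frac\beta2|y|^2$. The mapping $S_{\alpha,\beta}$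 is $PC^1$: it is continuous, and every $\bar x\in\mathbb R^n$ has an open neighborhood $U$ on which there are finitely many $C^1$ mappings $\varphi_1,\dots,\varphi_\ell$ with $S_{\alpha,\beta}(x)\in\{\varphi_1(x),\dots,\varphi_\ell(x)\}$ for all $x\in U$. Moreover, the selections can be indexed as follows. Let $I,J$ be finite index sets and $h(z)=\max_{j\in J}\{\langle a^j,z\rangle-\alpha_j\}$ if $\langle b^i,z\rangle-\beta_i\le0$ for all $i\in I$, and $h(z)=\infty$ otherwise. Put $z(x)=G(x,y(x))-\alpha p(x)$, $I(z)=\{i\in I:\langle b^i,z\rangle=\beta_i\}$ and $J(z)=\{j\in J:h(z)=\langle a^j,z\rangle-\alpha_j\}$. Fix $\bar x$ and write $\bar z=z(\bar x)$, $\bar p=p(\bar x)$. There exist coefficients $\sigma_j,\tau_i\ge0$ with $\sum_{j\in J(\bar z)}\sigma_j=1$ and $\bar p=\sum_{j\in J(\bar z)}\sigma_ja^j+\sum_{i\in I(\bar z)}\tau_ib^i$. For any such $(\sigma,\tau)$, call $(I^*,J^*)$ admissible if $\{i\in I(\bar z):\tau_i>0\}\subset I^*\subset I(\bar z)$ and $\{j\in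 J(\bar z):\sigma_j>0\}\subset J^*\subset J(\bar z)$. Then there are open neighborhoods $U$ of $\bar x$ and $V$ of $S_{\alpha,\beta}(\bar x)$ and, for each admissible $(I^*,J^*)$, a $C^1$ mapping $\varphi_{I^*,J^*}$ on $U$ with $\varphi_{I^*,J^*}(\bar x)=S_{\alpha,\beta}(\bar x)$ such that: (a) for every $\hat\jmath\in J^*$ and $x\in U$, $\varphi_{I^*,J^*}(x)$ is the only point of $V$ that solves the system defining $S_{\alpha,\beta}(x)$ with $h$ replaced by the function equal to $\langle a^{\hat\jmath},z\rangle-\alpha_{\hat\jmath}$ if $\langle a^j,z\rangle-\alpha_j=\langle a^{\hat\jmath},z\rangle-\alpha_{\hat\jmath}$ for all $j\in J^*$ and $\langle b^i,z\rangle=\beta_i$ for all $i\in I^*$, and equal to $\infty$ otherwise; (b) for every $x\in U$, the pair $(I(z(x)),J(z(x)))$ is admissible and $S_{\alpha,\beta}(x)=\varphi_{I(z(x)),J(z(x))}(x)$. -/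

import Mathlib

open Topology

noncomputable section

namespace Bilevel

/-- `ℝⁿ` with the Euclidean norm. -/
abbrev E (n : ℕ) : Type := EuclideanSpace ℝ (Fin n)

/-- `ℝᵐ × ℝˢ`, identified with the Euclidean space `ℝᵐ⁺ˢ`. -/
abbrev PD (m s : ℕ) : Type := WithLp 2 (E m × E s)

section ConvexAnalysis

variable {V : Type*} [NormedAddCommGroup V] [InnerProductSpace ℝ V]

/-- The effective domain is nonempty and the value `-∞` is never taken. -/
def IsProper (f : V → EReal) : Prop :=
  (∃ z, f z < ⊤) ∧ ∀ z, f z ≠ ⊥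

/-- The epigraph, as a subset of `V × ℝ`. -/
def epigraph (f : V → EReal) : Set (V × ℝ) :=
  {q | f q.1 ≤ (q.2 : EReal)}

/-- A polyhedral set in `V × ℝ`: a finite intersection of closed half-spaces. -/
def IsPolyhedral (C : Set (V × ℝ)) : Prop :=
  ∃ (k : ℕ) (c : Fin k → V) (d e : Fin k → ℝ),
    C = {q | ∀ l, inner ℝ (c l) q.1 + d l * q.2 ≤ e l}

/-- A function is epi-polyhedral if its epigraph is a polyhedral set. -/
def IsEpiPolyhedral (f : V → EReal) : Prop :=
  IsPolyhedral (epigraph f)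

/-- The indicator function `ι_C`: `0` on `C` and `∞` elsewhere. -/
def indicatorFun (C : Set V) (z : V) : EReal :=
  open Classical in if z ∈ C then 0 else ⊤

/-- The (Fenchel) conjugate `f*(p) = sup_z (⟨p, z⟩ - f z)`. -/
def conjugate (f : V → EReal) (p : V) : EReal :=
  ⨆ z, (((inner ℝ p z : ℝ) : EReal) - f z)

/-- The subdifferential of a convex function at `x`; it is empty where `f x` is not finite. -/
def subdifferential (f : V → EReal) (x : V) : Set V :=
  {u | f x ≠ ⊤ ∧ f x ≠ ⊥ ∧ ∀ x', f x + ((inner ℝ u (x' - x) : ℝ) : EReal) ≤ f x'}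

/-- The Moreau envelope `e_lam f (x) = inf_w (f w + |w - x|² / (2 lam))`. -/
def moreauEnvelope (lam : ℝ) (f : V → EReal) (x : V) : EReal :=
  ⨅ w, (f w + ((1 / (2 * lam) * ‖w - x‖ ^ 2 : ℝ) : EReal))

/-- The set of minimizers of an extended real-valued function. -/
def argmin (f : V → EReal) : Set V :=
  {y | f y < ⊤ ∧ ∀ y', f y ≤ f y'}

end ConvexAnalysis

/-- `h z ≤ h w` whenever `z ≤ w` component-wise. -/
def IsNondecreasing {s : ℕ} (h : E s → EReal) : Prop :=
  ∀ z w : E s, (∀ i, z i ≤ w i) → h z ≤ h w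

section Problem

variable {n m s : ℕ}

/-- The minimizers `Y_{α,β}(x)` of `y ↦ g(x,y) + e_α h (G(x,y)) + (β/2)|y|²`. -/
def regArgmin (g : E n → E m → ℝ) (G : E n → E m → E s) (h : E s → EReal)
    (α β : ℝ) (x : E n) : Set (E m) :=
  argmin fun y =>
    (g x y : EReal) + moreauEnvelope α h (G x y) + ((β / 2 * ‖y‖ ^ 2 : ℝ) : EReal)

/-- `ψ_x(y,p) = (-∇_y g(x,y) - ∇_y G(x,y)ᵀ p - β y, -G(x,y) + α p)`. -/
def psi (g : E n → E m → ℝ) (G : E n → E m → E s) (α β : ℝ) (x : E n) (q : PD m s) : PD m s :=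
  WithLp.toLp 2
    (-gradient (g x) q.fst - ContinuousLinearMap.adjoint (fderiv ℝ (G x) q.fst) q.snd
        - β • q.fst,
      -G x q.fst + α • q.snd)

/-- `h̃(y,p) = h*(p)`. -/
def hTilde (m : ℕ) {s : ℕ} (h : E s → EReal) (q : PD m s) : EReal :=
  conjugate h q.snd

/-- The primal-dual solutions at `x`: all `(y,p)` with `0 ∈ ψ_x(y,p) + ∂h̃(y,p)`. -/
def solSet (g : E n → E m → ℝ) (G : E n → E m → E s) (h : E s → EReal)
    (α β : ℝ) (x : E n) : Set (PD m s) :=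
  {q | -psi g G α β x q ∈ subdifferential (hTilde m h) q}

/-- The point `G(x,y) - α p`. -/
def shifted (G : E n → E m → E s) (α : ℝ) (x : E n) (q : PD m s) : E s :=
  G x q.fst - α • q.snd

end Problem

/-- Piecewise `C¹` mappings: continuous, and near every point a selection of finitely many
mappings that are `C¹` there. -/
def IsPC1 {V W : Type*} [NormedAddCommGroup V] [NormedSpace ℝ V]
    [NormedAddCommGroup W] [NormedSpace ℝ W] (F : V → W) : Prop :=
  Continuous F ∧ ∀ x₀ : V, ∃ U : Set V, IsOpen U ∧ x₀ ∈ U ∧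
    ∃ (k : ℕ) (φ : Fin k → V → W),
      (∀ l, ContDiffOn ℝ 1 (φ l) U) ∧ ∀ x ∈ U, ∃ l, F x = φ l x

/-- Coefficients of affine pieces `⟨a j, ·⟩ - c j` and constraints `⟨b i, ·⟩ - d i ≤ 0`. -/
structure PolyData (s : ℕ) (I J : Type) where
  a : J → E s
  c : J → ℝ
  b : I → E s
  d : I → ℝ

namespace PolyData

variable {s : ℕ} {I J : Type} (D : PolyData s I J)

/-- The set `{z | ⟨b i, z⟩ - d i ≤ 0 for all i}`. -/
def constraintSet : Set (E s) :=
  {z | ∀ i, inner ℝ (D.b i) z - D.d i ≤ 0}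

/-- The function `max_j (⟨a j, z⟩ - c j) + ι(z)`, `ι` the indicator of the constraint set. -/
def toFun (z : E s) : EReal :=
  (⨆ j, ((inner ℝ (D.a j) z - D.c j : ℝ) : EReal)) + indicatorFun D.constraintSet z

/-- Active constraints at `z`. -/
def activeI (z : E s) : Set I :=
  {i | inner ℝ (D.b i) z - D.d i = 0}

/-- Active affine pieces at `z`. -/
def activeJ (z : E s) : Set J :=
  {j | D.toFun z = ((inner ℝ (D.a j) z - D.c j : ℝ) : EReal)}

/-- `(σ, τ)` represents `p` at `z`: `p = ∑_{j ∈ J(z)} σ j • a j + ∑_{i ∈ I(z)} τ i • b i` with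
`σ, τ ≥ 0` and `∑ σ j = 1`; both are extended by `0` to the inactive indices. -/
structure Represents [Fintype I] [Fintype J] (z p : E s) (σ : J → ℝ) (τ : I → ℝ) : Prop where
  sigma_nonneg : ∀ j, 0 ≤ σ j
  tau_nonneg : ∀ i, 0 ≤ τ i
  sigma_inactive : ∀ j, j ∉ D.activeJ z → σ j = 0
  tau_inactive : ∀ i, i ∉ D.activeI z → τ i = 0
  sigma_sum : ∑ j, σ j = 1
  eq : p = ∑ j, σ j • D.a j + ∑ i, τ i • D.b i

/-- `(I', J')` is an admissible pair of index sets at `z` for `(σ, τ)`: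
`{i | τ i > 0} ⊆ I' ⊆ I(z)` and `{j | σ j > 0} ⊆ J' ⊆ J(z)`. -/
def Admissible (z : E s) (σ : J → ℝ) (τ : I → ℝ) (I' : Set I) (J' : Set J) : Prop :=
  {i | 0 < τ i} ⊆ I' ∧ I' ⊆ D.activeI z ∧ {j | 0 < σ j} ⊆ J' ∧ J' ⊆ D.activeJ z

/-- The affine piece of index `j₀`, restricted to the affine set on which all pieces in `J'`
agree with it and all constraints in `I'` are equalities. -/
def reduced (I' : Set I) (J' : Set J) (j₀ : J) (z : E s) : EReal :=
  ((inner ℝ (D.a j₀) z - D.c j₀ : ℝ) : EReal) +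
    indicatorFun {z | (∀ j ∈ J', inner ℝ (D.a j) z - D.c j = inner ℝ (D.a j₀) z - D.c j₀) ∧
      ∀ i ∈ I', inner ℝ (D.b i) z - D.d i = 0} z

end PolyData

end Bilevel

end

noncomputable section

namespace Bilevel

/-! ### Subgradients, conjugates and tangent inequalities. -/

section Duality

variable {V : Type*} [NormedAddCommGroup V] [InnerProductSpace ℝ V]

/-! A proper epi-polyhedral `h` is a maximum of affine pieces plus the indicator of affine
inequalities (`exists_polyData`). Its proximal point exists everywhere: every `z` has some `p ∈ ∂h(z
- αp)`, and this `p` is the gradient of the Moreau envelope at `z`. Hence the regularized objective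
is differentiable and coercive, and stationarity of a minimizer `y` says that `y` together with the
`p` found at `G(x,y)` solves the primal-dual system. Uniqueness is strong monotonicity: since `h` is
nondecreasing, all relevant multipliers are nonnegative, so `⟨p, G(x,·)⟩` is convex; the terms `βy`
and `αp` supply the moduli. The same estimate with two different parameters gives continuity
(`norm_sub_le_of_mem_solSet`). As `p ∈ ∂h(z)` comes from the construction, only the easy half of
conjugate inversion is needed.

For smoothness, replace `h` by one affine piece on an affine set with direction space `M`. The
condition on `h*` then becomes `p - a ∈ Mᗮ`, `z - z₀ ∈ M`, so the reduced problem is a square `C¹`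
system. A kernel vector `(v, p)` of its derivative has `p ∈ Mᗮ` and `DG v - αp ∈ M`, so `⟨p, DG v⟩ =
α|p|²`; coercivity gives `β|v|² + α|p|² ≤ 0`, and the implicit function theorem applies.

It remains to see that the index sets active at `z(x)` are admissible near `x̄`. Subgradients at a
point form a closed set depending only on the active indices, and there are finitely many such sets,
so for `x` near `x̄` the limit `p̄` is itself a subgradient at `z(x)`. Complementary slackness then
forces every index with a positive coefficient to be active at `z(x)` (`Represents.support_subset`).
-/

theorem mem_subdifferential_iff_of_eq_coe {f : V → EReal} {x u : V} {r : ℝ} (hr : f x = r) :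
    u ∈ subdifferential f x ↔ ∀ x', ((r + inner ℝ u (x' - x) : ℝ) : EReal) ≤ f x' := by
  simp [subdifferential, hr]

theorem exists_real_of_mem_subdifferential {f : V → EReal} {x u : V}
    (hu : u ∈ subdifferential f x) : ∃ r : ℝ, f x = r :=
  ⟨(f x).toReal, (EReal.coe_toReal hu.1 hu.2.1).symm⟩

theorem conjugate_eq_of_mem_subdifferential {f : V → EReal} {x u : V} {r : ℝ} (hr : f x = r)
    (hu : u ∈ subdifferential f x) : conjugate f u = ((inner ℝ u x - r : ℝ) : EReal) := by
  rw [mem_subdifferential_iff_of_eq_coe hr] at hu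
  apply le_antisymm
  · refine iSup_le fun z => ?_
    have hz := hu z
    induction hfz : f z with
    | bot => simp [hfz] at hz
    | top => simp
    | coe t =>
      rw [hfz] at hz
      rw [← EReal.coe_sub]
      rw [EReal.coe_le_coe_iff] at hz ⊢
      rw [inner_sub_right] at hz
      linarith
  · refine le_trans ?_ (le_iSup _ x)
    rw [hr, ← EReal.coe_sub]

/-- The easy half of subgradient inversion for conjugates. -/
theorem mem_subdifferential_conjugate {f : V → EReal} {x u : V}
    (hu : u ∈ subdifferential f x) : x ∈ subdifferential (conjugate f) u := by
  obtain ⟨r, hr⟩ := exists_real_of_mem_subdifferential hu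
  rw [mem_subdifferential_iff_of_eq_coe (conjugate_eq_of_mem_subdifferential hr hu)]
  intro u'
  refine le_trans ?_ (le_iSup _ x)
  rw [hr, ← EReal.coe_sub, EReal.coe_le_coe_iff, inner_sub_right, real_inner_comm x u,
    real_inner_comm x u']
  linarith

theorem subdifferential_monotone {f : V → EReal} {x y u v : V}
    (hu : u ∈ subdifferential f x) (hv : v ∈ subdifferential f y) :
    0 ≤ inner ℝ (u - v) (x - y) := by
  obtain ⟨r, hr⟩ := exists_real_of_mem_subdifferential hu
  obtain ⟨t, ht⟩ := exists_real_of_mem_subdifferential hv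
  have h1 := (mem_subdifferential_iff_of_eq_coe hr).1 hu y
  have h2 := (mem_subdifferential_iff_of_eq_coe ht).1 hv x
  rw [ht, EReal.coe_le_coe_iff] at h1
  rw [hr, EReal.coe_le_coe_iff] at h2
  simp only [inner_sub_left, inner_sub_right] at *
  linarith

/-- If `p` is a subgradient at `z - lam • p`, then `z - lam • p` attains the Moreau envelope
at `z`. -/
theorem moreauEnvelope_eq_of_mem_subdifferential {f : V → EReal} {lam : ℝ} (hl : 0 < lam)
    {z p : V} {r : ℝ} (hr : f (z - lam • p) = r) (hp : p ∈ subdifferential f (z - lam • p)) :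
    moreauEnvelope lam f z = ((r + lam / 2 * ‖p‖ ^ 2 : ℝ) : EReal) := by
  rw [mem_subdifferential_iff_of_eq_coe hr] at hp
  apply le_antisymm
  · refine (iInf_le _ (z - lam • p)).trans ?_
    rw [hr, ← EReal.coe_add, EReal.coe_le_coe_iff]
    have : z - lam • p - z = -(lam • p) := by abel
    rw [this, norm_neg, norm_smul, mul_pow, Real.norm_eq_abs, sq_abs]
    apply le_of_eq
    field_simp
  · refine le_iInf fun w => ?_
    have hw := hp w
    refine le_trans ?_ (add_le_add_left hw _)
    rw [← EReal.coe_add, EReal.coe_le_coe_iff]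
    have h1 : w - (z - lam • p) = (w - z) + lam • p := by abel
    rw [h1, inner_add_right, inner_smul_right, real_inner_self_eq_norm_sq]
    have h2 : 0 ≤ ‖(w - z) + lam • p‖ ^ 2 := sq_nonneg _
    rw [norm_add_sq_real, norm_smul, mul_pow, Real.norm_eq_abs, sq_abs, inner_smul_right,
      real_inner_comm p (w - z)] at h2
    -- Completing the square: the gap is `‖(w - z) + lam • p‖² / (2 lam)`.
    have h3 : 1 / (2 * lam) * ‖w - z‖ ^ 2 + inner ℝ p (w - z) + lam / 2 * ‖p‖ ^ 2
        = 1 / (2 * lam) * (‖w - z‖ ^ 2 + 2 * (lam * inner ℝ p (w - z)) + lam ^ 2 * ‖p‖ ^ 2) := by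
      field_simp
    have h4 := mul_nonneg (by positivity : 0 ≤ 1 / (2 * lam)) h2
    rw [← h3] at h4
    linarith

theorem _root_.ConvexOn.add_fderiv_le {V : Type*} [NormedAddCommGroup V] [NormedSpace ℝ V]
    {f : V → ℝ} {f' : V →L[ℝ] ℝ} {y : V}
    (hf : ConvexOn ℝ Set.univ f) (hd : HasFDerivAt f f' y) (y' : V) :
    f y + f' (y' - y) ≤ f y' := by
  have hk : ConvexOn ℝ Set.univ (fun t : ℝ => f (AffineMap.lineMap y y' t)) := by
    have := hf.comp_affineMap (AffineMap.lineMap (k := ℝ) y y')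
    rw [Set.preimage_univ] at this
    exact this
  have hd' : HasDerivAt (fun t : ℝ => f (AffineMap.lineMap y y' t)) (f' (y' - y)) 0 := by
    have h0 : HasFDerivAt f f' (AffineMap.lineMap y y' (0 : ℝ)) := by simpa using hd
    exact h0.comp_hasDerivAt 0 AffineMap.hasDerivAt_lineMap
  have := hk.le_slope_of_hasDerivAt (Set.mem_univ 0) (Set.mem_univ 1) one_pos hd'
  simp only [slope, vsub_eq_sub, AffineMap.lineMap_apply_one, AffineMap.lineMap_apply_zero, sub_zero,
    inv_one, one_smul] at this
  linarith

end Duality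

/-! ### Farkas' lemma by elimination of one functional. -/

section Farkas

/-- **Farkas' lemma** for finitely many linear functionals. -/
theorem farkas {W ι : Type*} [AddCommGroup W] [Module ℝ W] (t : Finset ι) :
    ∀ (v : ι → W →ₗ[ℝ] ℝ) (p : W →ₗ[ℝ] ℝ),
      (∀ w, (∀ i ∈ t, v i w ≤ 0) → p w ≤ 0) →
        ∃ c : ι → ℝ, (∀ i, 0 ≤ c i) ∧ (∀ i ∉ t, c i = 0) ∧ p = ∑ i ∈ t, c i • v i := by
  classical
  induction t using Finset.induction_on with
  | empty =>
    intro v p hp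
    refine ⟨0, by simp, by simp, ?_⟩
    ext w
    have h1 := hp w (by simp)
    have h2 := hp (-w) (by simp)
    simp at h1 h2 ⊢
    linarith
  | insert k t hk ih =>
    intro v p hp
    -- If the functional `k` is redundant it gets coefficient zero. Otherwise a violating vector,
    -- scaled so that `v k` is `1` on it, serves to project onto the kernel of `v k`, where
    -- induction applies.
    by_cases hcase : ∀ w, (∀ i ∈ t, v i w ≤ 0) → p w ≤ 0
    · obtain ⟨c, hc, hc0, rfl⟩ := ih v p hcase
      refine ⟨c, hc, fun i hi => hc0 i fun h => hi (Finset.mem_insert_of_mem h), ?_⟩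
      rw [Finset.sum_insert hk, hc0 k hk]
      simp
    · push Not at hcase
      obtain ⟨w₁, hw₁, hpw₁⟩ := hcase
      have hvk : 0 < v k w₁ := by
        by_contra hcon
        refine absurd (hp w₁ fun i hi => ?_) (not_le.2 hpw₁)
        rcases Finset.mem_insert.1 hi with rfl | hi
        · exact not_lt.1 hcon
        · exact hw₁ i hi
      obtain ⟨w₀, hw₀, hpw₀, hvk₀⟩ : ∃ w₀, (∀ i ∈ t, v i w₀ ≤ 0) ∧ 0 < p w₀ ∧ v k w₀ = 1 := by
        refine ⟨(v k w₁)⁻¹ • w₁, fun i hi => ?_, ?_, ?_⟩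
        · simpa using mul_nonpos_of_nonneg_of_nonpos (inv_pos.2 hvk).le (hw₁ i hi)
        · simpa using mul_pos (inv_pos.2 hvk) hpw₁
        · simp [hvk.ne']
      obtain ⟨c, hc, hc0, hceq⟩ := ih (fun i => v i - v i w₀ • v k) (p - p w₀ • v k) (by
        intro w hw
        have := hp (w - v k w • w₀) (by
          intro i hi
          rcases Finset.mem_insert.1 hi with rfl | hi
          · simp [hvk₀]
          · have := hw i hi
            simp at this ⊢
            linarith)
        simp at this ⊢
        linarith)
      -- The coefficient of `k` collects the multiples of `v k` subtracted in the projection; it is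
      -- nonnegative because `p w₀ > 0` and `v i w₀ ≤ 0` on `t`.
      refine ⟨fun i => if i = k then p w₀ - ∑ i ∈ t, c i * v i w₀ else c i, fun i => ?_,
        fun i hi => ?_, ?_⟩
      · dsimp only
        split_ifs
        · have : ∑ i ∈ t, c i * v i w₀ ≤ 0 :=
            Finset.sum_nonpos fun i hi => mul_nonpos_of_nonneg_of_nonpos (hc i) (hw₀ i hi)
          linarith
        · exact hc i
      · rw [Finset.mem_insert, not_or] at hi
        simp [hi.1, hc0 i hi.2]
      · rw [Finset.sum_insert hk]
        have hsum : ∑ i ∈ t, (if i = k then p w₀ - ∑ i ∈ t, c i * v i w₀ else c i) • v i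
            = ∑ i ∈ t, c i • v i :=
          Finset.sum_congr rfl fun i hi => by
            rw [if_neg (by rintro rfl; exact hk hi)]
        rw [hsum]
        ext w
        have := congrArg (fun l => l w) hceq
        simp [mul_sub, Finset.sum_sub_distrib] at this ⊢
        rw [sub_mul, Finset.sum_mul]
        simp only [mul_assoc]
        linarith

end Farkas

/-! ### Monotonicity of `h` makes multipliers nonnegative. -/

section Nondecreasing

variable {s : ℕ} {h : E s → EReal}

/-- If `p i < 0`, moving along `-eᵢ` does not increase `h` while `⟨p, ·⟩` grows without bound, so
the supremum is infinite. -/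
theorem nonneg_of_conjugate_ne_top (hp : IsProper h) (hm : IsNondecreasing h) {p : E s}
    (hc : conjugate h p ≠ ⊤) (i : Fin s) : 0 ≤ p i := by
  by_contra hneg
  push Not at hneg
  obtain ⟨⟨z, hz⟩, hbot⟩ := hp
  obtain ⟨r, hr⟩ : ∃ r : ℝ, h z = r := ⟨(h z).toReal, (EReal.coe_toReal hz.ne (hbot z)).symm⟩
  apply hc
  rw [EReal.eq_top_iff_forall_lt]
  intro y
  obtain ⟨t, ht0, ht⟩ : ∃ t : ℝ, 0 ≤ t ∧ y < inner ℝ p z - r - t * p i := by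
    refine ⟨(|y - (inner ℝ p z - r)| + 1) / (-p i), by
      have := neg_pos.2 hneg
      positivity, ?_⟩
    have : (|y - (inner ℝ p z - r)| + 1) / (-p i) * p i = -(|y - (inner ℝ p z - r)| + 1) := by
      field_simp [hneg.ne]
    rw [this]
    have := le_abs_self (y - (inner ℝ p z - r))
    linarith
  set z' : E s := z - t • EuclideanSpace.single i (1 : ℝ) with hz'
  have hle : h z' ≤ r := by
    rw [← hr]
    apply hm
    intro k
    by_cases hk : k = i
    · subst hk; simpa [hz'] using ht0
    · simp [hz', hk]
  have hin : inner ℝ p z' = inner ℝ p z - t * p i := by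
    rw [hz', inner_sub_right, inner_smul_right, EuclideanSpace.inner_single_right]
    simp
  have h1 : (y : EReal) < ((inner ℝ p z' - r : ℝ) : EReal) := by
    rw [EReal.coe_lt_coe_iff, hin]; linarith
  refine h1.trans_le (le_trans ?_ (le_iSup _ z'))
  rw [EReal.coe_sub]
  exact EReal.sub_le_sub le_rfl hle

theorem nonneg_of_mem_subdifferential (hm : IsNondecreasing h) {z p : E s}
    (hp : p ∈ subdifferential h z) (i : Fin s) : 0 ≤ p i := by
  obtain ⟨r, hr⟩ := exists_real_of_mem_subdifferential hp
  have h1 := (mem_subdifferential_iff_of_eq_coe hr).1 hp (z - EuclideanSpace.single i (1 : ℝ))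
  have h2 : h (z - EuclideanSpace.single i (1 : ℝ)) ≤ r := by
    rw [← hr]
    apply hm
    intro k
    by_cases hk : k = i
    · subst hk; simp
    · simp [hk]
  have := EReal.coe_le_coe_iff.1 (h1.trans h2)
  simp only [sub_sub_cancel_left, inner_neg_right, EuclideanSpace.inner_single_right] at this
  simpa using this

end Nondecreasing

/-! ### The inclusion split into its two conditions. -/

section SolSet

variable {n m s : ℕ} {g : E n → E m → ℝ} {G : E n → E m → E s}

/-- The gradient in `y` of `g(x,y) + ⟨p, G(x,y)⟩ + (β/2)|y|²`. -/
def lagrGrad (g : E n → E m → ℝ) (G : E n → E m → E s) (β : ℝ) (x : E n) (y : E m) (p : E s) :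
    E m :=
  gradient (g x) y + ContinuousLinearMap.adjoint (fderiv ℝ (G x) y) p + β • y

/-- The function does not depend on its first argument; testing the subgradient inequality at a
shift by `u.fst` gives `‖u.fst‖² ≤ 0`. -/
theorem mem_subdifferential_hTilde {h : E s → EReal} {q u : PD m s} :
    u ∈ subdifferential (hTilde m h) q ↔
      u.fst = 0 ∧ u.snd ∈ subdifferential (conjugate h) q.snd := by
  constructor
  · intro hu
    obtain ⟨r, hr⟩ := exists_real_of_mem_subdifferential hu
    have hu' := (mem_subdifferential_iff_of_eq_coe hr).1 hu
    have hr' : conjugate h q.snd = r := hr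
    refine ⟨?_, ?_⟩
    · have := hu' (WithLp.toLp 2 (q.fst + u.fst, q.snd))
      have h2 : hTilde m h (WithLp.toLp 2 (q.fst + u.fst, q.snd)) = r := hr
      rw [h2, EReal.coe_le_coe_iff, WithLp.prod_inner_apply] at this
      simpa using this
    · rw [mem_subdifferential_iff_of_eq_coe hr']
      intro p'
      have := hu' (WithLp.toLp 2 (q.fst, p'))
      rw [WithLp.prod_inner_apply] at this
      simpa [hTilde] using this
  · rintro ⟨h0, hu⟩
    obtain ⟨r, hr⟩ := exists_real_of_mem_subdifferential hu
    have hr' : hTilde m h q = r := hr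
    rw [mem_subdifferential_iff_of_eq_coe hr']
    intro q'
    have := (mem_subdifferential_iff_of_eq_coe hr).1 hu q'.snd
    rw [WithLp.prod_inner_apply]
    have e : (WithLp.ofLp u).1 = 0 := h0
    rw [e, inner_zero_left, zero_add]
    exact this

theorem mem_solSet_iff {h : E s → EReal} {α β : ℝ} {x : E n} {q : PD m s} :
    q ∈ solSet g G h α β x ↔
      lagrGrad g G β x q.fst q.snd = 0 ∧
        shifted G α x q ∈ subdifferential (conjugate h) q.snd := by
  change -psi g G α β x q ∈ subdifferential (hTilde m h) q ↔ _
  rw [mem_subdifferential_hTilde]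
  have h1 : (-psi g G α β x q).fst = lagrGrad g G β x q.fst q.snd := by
    simp [psi, lagrGrad]
    abel
  have h2 : (-psi g G α β x q).snd = shifted G α x q := by
    simp [psi, shifted]
    abel
  rw [h1, h2]

end SolSet

/-! ### Subgradients of polyhedral functions. -/

namespace PolyData

variable {s : ℕ} {I J : Type} (D : PolyData s I J)

/-- The value at `z` of the affine piece of index `j`. -/
def piece (j : J) (z : E s) : ℝ := inner ℝ (D.a j) z - D.c j

/-- The maximum of the affine pieces. -/
def maxPiece (z : E s) : ℝ := ⨆ j, D.piece j z

theorem piece_add (j : J) (z w : E s) : D.piece j (z + w) = D.piece j z + inner ℝ (D.a j) w := by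
  simp only [piece, inner_add_right]; ring

theorem continuous_piece (j : J) : Continuous (D.piece j) := by
  unfold piece; fun_prop

theorem isClosed_constraintSet : IsClosed D.constraintSet := by
  have : D.constraintSet = ⋂ i, {z | inner ℝ (D.b i) z - D.d i ≤ 0} := by
    ext z; simp [constraintSet]
  rw [this]
  exact isClosed_iInter fun i => isClosed_le (by fun_prop) continuous_const

theorem convex_constraintSet : Convex ℝ D.constraintSet := by
  intro z hz w hw u v hu hv huv i
  have h1 := mul_nonpos_of_nonneg_of_nonpos hu (hz i)
  have h2 := mul_nonpos_of_nonneg_of_nonpos hv (hw i)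
  rw [inner_add_right, inner_smul_right, inner_smul_right]
  have : D.d i = u * D.d i + v * D.d i := by rw [← add_mul, huv, one_mul]
  nlinarith

theorem toFun_of_notMem {z : E s} (hz : z ∉ D.constraintSet) [Nonempty J] : D.toFun z = ⊤ := by
  rw [toFun, indicatorFun, if_neg hz]
  apply EReal.add_top_of_ne_bot
  obtain ⟨j⟩ := ‹Nonempty J›
  exact ne_bot_of_le_ne_bot (EReal.coe_ne_bot _)
    (le_iSup (fun j => ((inner ℝ (D.a j) z - D.c j : ℝ) : EReal)) j)

theorem mem_constraintSet_of_mem_subdifferential [Nonempty J] {z p : E s}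
    (hp : p ∈ subdifferential D.toFun z) : z ∈ D.constraintSet := by
  by_contra hz
  exact hp.1 (D.toFun_of_notMem hz)

theorem nonempty_of_isProper (h : IsProper D.toFun) : Nonempty J := by
  by_contra hJ
  rw [not_nonempty_iff] at hJ
  apply h.2 0
  simp [toFun]

section Finite

variable [Finite J]

theorem piece_le_maxPiece (j : J) (z : E s) : D.piece j z ≤ D.maxPiece z :=
  le_ciSup (f := fun j => D.piece j z) (Set.finite_range _).bddAbove j

variable [Nonempty J]

theorem exists_piece_eq_maxPiece (z : E s) : ∃ j, D.piece j z = D.maxPiece z :=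
  exists_eq_ciSup_of_finite

theorem continuous_maxPiece : Continuous D.maxPiece := by
  have := Fintype.ofFinite J
  have : D.maxPiece = fun z => Finset.univ.sup' Finset.univ_nonempty fun j => D.piece j z := by
    ext z
    rw [Finset.sup'_univ_eq_ciSup, maxPiece]
  rw [this]
  exact Continuous.finset_sup'_apply _ fun j _ => D.continuous_piece j

theorem maxPiece_combo_le (z w : E s) {u v : ℝ} (hu : 0 ≤ u) (hv : 0 ≤ v) (huv : u + v = 1) :
    D.maxPiece (u • z + v • w) ≤ u * D.maxPiece z + v * D.maxPiece w := by
  obtain ⟨j, hj⟩ := D.exists_piece_eq_maxPiece (u • z + v • w)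
  have h1 := mul_le_mul_of_nonneg_left (D.piece_le_maxPiece j z) hu
  have h2 := mul_le_mul_of_nonneg_left (D.piece_le_maxPiece j w) hv
  have : D.piece j (u • z + v • w) = u * D.piece j z + v * D.piece j w := by
    simp only [piece, inner_add_right, inner_smul_right]
    have : D.c j = u * D.c j + v * D.c j := by rw [← add_mul, huv, one_mul]
    nlinarith
  linarith

theorem toFun_of_mem {z : E s} (hz : z ∈ D.constraintSet) : D.toFun z = (D.maxPiece z : EReal) := by
  rw [toFun, indicatorFun, if_pos hz, add_zero]
  apply le_antisymm
  · exact iSup_le fun j => EReal.coe_le_coe_iff.2 (D.piece_le_maxPiece j z)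
  · obtain ⟨j, hj⟩ := D.exists_piece_eq_maxPiece z
    rw [← hj]
    exact le_iSup (fun j => ((inner ℝ (D.a j) z - D.c j : ℝ) : EReal)) j

theorem toFun_le_coe_iff {z : E s} {r : ℝ} :
    D.toFun z ≤ r ↔ (∀ i, inner ℝ (D.b i) z ≤ D.d i) ∧ ∀ j, inner ℝ (D.a j) z - D.c j ≤ r := by
  by_cases hz : z ∈ D.constraintSet
  · rw [D.toFun_of_mem hz, EReal.coe_le_coe_iff]
    refine ⟨fun h => ⟨fun i => by have := hz i; linarith,
      fun j => (D.piece_le_maxPiece j z).trans h⟩, fun h => ?_⟩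
    obtain ⟨j, hj⟩ := D.exists_piece_eq_maxPiece z
    rw [← hj]
    exact h.2 j
  · rw [D.toFun_of_notMem hz]
    refine ⟨fun h => absurd (top_le_iff.1 h) (EReal.coe_ne_top r), fun h => ?_⟩
    exact absurd (fun i => sub_nonpos.2 (h.1 i)) hz

theorem mem_activeJ_iff {z : E s} (hz : z ∈ D.constraintSet) {j : J} :
    j ∈ D.activeJ z ↔ D.piece j z = D.maxPiece z := by
  change D.toFun z = (D.piece j z : EReal) ↔ _
  rw [D.toFun_of_mem hz, EReal.coe_eq_coe_iff, eq_comm]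

theorem mem_subdifferential_iff_of_mem {z p : E s} (hz : z ∈ D.constraintSet) :
    p ∈ subdifferential D.toFun z ↔
      ∀ w ∈ D.constraintSet, D.maxPiece z + inner ℝ p (w - z) ≤ D.maxPiece w := by
  rw [mem_subdifferential_iff_of_eq_coe (D.toFun_of_mem hz)]
  refine forall_congr' fun w => ?_
  by_cases hw : w ∈ D.constraintSet
  · simp only [D.toFun_of_mem hw, EReal.coe_le_coe_iff, hw, forall_const]
  · simp [D.toFun_of_notMem hw, hw]

end Finite

/-- The subgradients at a point whose active index sets are `I'` and `J'`, described by the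
directional derivative. -/
def normalSet (I' : Set I) (J' : Set J) : Set (E s) :=
  {p | ∀ w, (∀ i ∈ I', inner ℝ (D.b i) w ≤ 0) → ∃ j ∈ J', inner ℝ p w ≤ inner ℝ (D.a j) w}

/-- Finiteness of `J` keeps the union of half-spaces closed. Closedness is what transfers
subgradients from nearby solutions to the limit. -/
theorem isClosed_normalSet [Finite J] (I' : Set I) (J' : Set J) :
    IsClosed (D.normalSet I' J') := by
  have : D.normalSet I' J' = ⋂ w : {w : E s // ∀ i ∈ I', inner ℝ (D.b i) w ≤ 0},
      ⋃ j ∈ J', {p | inner ℝ p w.1 ≤ inner ℝ (D.a j) w.1} := by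
    ext p; simp [normalSet]
  rw [this]
  exact isClosed_iInter fun w => J'.toFinite.isClosed_biUnion fun j _ =>
    isClosed_le (by fun_prop) continuous_const

/-- Along a direction feasible for the active constraints, a short step keeps the inactive
constraints satisfied and the inactive pieces below the maximum, so only active indices matter.
Conversely, apply the directional condition to `w - z`. -/
theorem mem_subdifferential_iff_mem_normalSet [Finite I] [Finite J] [Nonempty J] {z p : E s}
    (hz : z ∈ D.constraintSet) :
    p ∈ subdifferential D.toFun z ↔ p ∈ D.normalSet (D.activeI z) (D.activeJ z) := by
  rw [D.mem_subdifferential_iff_of_mem hz]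
  constructor
  · intro hp w hw
    by_contra! hcon
    have hline : Continuous fun t : ℝ => z + t • w := by fun_prop
    have hfeas : ∀ᶠ t : ℝ in 𝓝[>] 0, ∀ i, inner ℝ (D.b i) (z + t • w) - D.d i ≤ 0 := by
      rw [Filter.eventually_all]
      intro i
      by_cases hi : i ∈ D.activeI z
      · filter_upwards [self_mem_nhdsWithin] with t ht
        have h1 : inner ℝ (D.b i) z - D.d i = 0 := hi
        have h2 := mul_nonpos_of_nonneg_of_nonpos (le_of_lt ht) (hw i hi)
        rw [inner_add_right, inner_smul_right]
        linarith
      · have h1 : inner ℝ (D.b i) z - D.d i < 0 := lt_of_le_of_ne (hz i) hi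
        have hc : Continuous fun t : ℝ => inner ℝ (D.b i) (z + t • w) - D.d i := by fun_prop
        have := hc.continuousAt.eventually_lt (continuousAt_const (y := (0 : ℝ)) (x := (0 : ℝ)))
          (by simpa using h1)
        exact (this.filter_mono nhdsWithin_le_nhds).mono fun _ => le_of_lt
    have hmax : ∀ᶠ t : ℝ in 𝓝[>] 0, ∀ j,
        D.piece j (z + t • w) < D.maxPiece z + t * inner ℝ p w := by
      rw [Filter.eventually_all]
      intro j
      by_cases hj : j ∈ D.activeJ z
      · filter_upwards [self_mem_nhdsWithin] with t ht
        have h1 := (D.mem_activeJ_iff hz).1 hj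
        have h2 := mul_lt_mul_of_pos_left (hcon j hj) ht
        rw [piece_add, inner_smul_right]
        linarith
      · have h1 : D.piece j z < D.maxPiece z :=
          lt_of_le_of_ne (D.piece_le_maxPiece j z) fun h => hj ((D.mem_activeJ_iff hz).2 h)
        have hc : Continuous fun t : ℝ => D.piece j (z + t • w) :=
          (D.continuous_piece j).comp hline
        have hc' : Continuous fun t : ℝ => D.maxPiece z + t * inner ℝ p w := by fun_prop
        have := hc.continuousAt.eventually_lt (hc'.continuousAt (x := (0 : ℝ)))
          (by simpa using h1)
        exact this.filter_mono nhdsWithin_le_nhds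
    obtain ⟨t, h1, h2⟩ := (hfeas.and hmax).exists
    obtain ⟨j, hj⟩ := D.exists_piece_eq_maxPiece (z + t • w)
    have h3 := hp _ h1
    have h4 := h2 j
    rw [add_sub_cancel_left, inner_smul_right] at h3
    linarith
  · intro hp w hw
    obtain ⟨j, hj, hle⟩ := hp (w - z) fun i hi => by
      have h1 : inner ℝ (D.b i) z - D.d i = 0 := hi
      have h2 := hw i
      rw [inner_sub_right]
      linarith
    have h1 := (D.mem_activeJ_iff hz).1 hj
    have h2 := D.piece_le_maxPiece j w
    have h3 := D.piece_add j z (w - z)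
    rw [add_sub_cancel] at h3
    linarith

/-- Homogenization: Farkas is applied in `E s × ℝ` to `⟨a j, w⟩ + r` and `⟨b i, w⟩`. Evaluating the
identity at `(0, 1)` gives `∑ σ j = 1`, at `(w, 0)` the formula for `p`. -/
theorem exists_coeff_of_mem_normalSet [Fintype I] [Fintype J] {I' : Set I} {J' : Set J} {p : E s}
    (hp : p ∈ D.normalSet I' J') :
    ∃ (σ : J → ℝ) (τ : I → ℝ), (∀ j, 0 ≤ σ j) ∧ (∀ i, 0 ≤ τ i) ∧ (∀ j ∉ J', σ j = 0) ∧
      (∀ i ∉ I', τ i = 0) ∧ ∑ j, σ j = 1 ∧ p = ∑ j, σ j • D.a j + ∑ i, τ i • D.b i := by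
  classical
  let v : J ⊕ I → (E s × ℝ) →ₗ[ℝ] ℝ :=
    Sum.elim (fun j => (innerₛₗ ℝ (D.a j)).coprod LinearMap.id)
      (fun i => (innerₛₗ ℝ (D.b i)).coprod 0)
  obtain ⟨c, hc, hc0, heq⟩ := farkas
    (Finset.univ.filter fun k : J ⊕ I => Sum.elim (· ∈ J') (· ∈ I') k) v
    ((innerₛₗ ℝ p).coprod LinearMap.id) (by
      rintro ⟨w, r⟩ hw
      obtain ⟨j, hj, hle⟩ := hp w fun i hi => by
        have := hw (Sum.inr i) (by simpa using hi)
        simpa [v] using this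
      have := hw (Sum.inl j) (by simpa using hj)
      simp [v] at this ⊢
      linarith)
  have hfull : ∑ i ∈ (Finset.univ.filter fun k : J ⊕ I => Sum.elim (· ∈ J') (· ∈ I') k), c i • v i
      = ∑ i, c i • v i :=
    Finset.sum_subset (Finset.subset_univ _) fun i _ hi => by rw [hc0 i hi, zero_smul]
  rw [hfull, Fintype.sum_sum_type] at heq
  refine ⟨fun j => c (Sum.inl j), fun i => c (Sum.inr i), fun j => hc _, fun i => hc _,
    fun j hj => hc0 _ (by simpa using hj), fun i hi => hc0 _ (by simpa using hi), ?_, ?_⟩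
  · have := congrArg (fun l => l ((0 : E s), (1 : ℝ))) heq
    simp [v] at this
    exact this.symm
  · refine ext_inner_right ℝ fun w => ?_
    have := congrArg (fun l => l (w, (0 : ℝ))) heq
    simp [v] at this
    simp [inner_add_left, sum_inner, inner_smul_left, this]

theorem exists_represents [Fintype I] [Fintype J] [Nonempty J] {z p : E s}
    (hp : p ∈ subdifferential D.toFun z) : ∃ σ τ, D.Represents z p σ τ := by
  rw [D.mem_subdifferential_iff_mem_normalSet (D.mem_constraintSet_of_mem_subdifferential hp)] at hp
  obtain ⟨σ, τ, h1, h2, h3, h4, h5, h6⟩ := D.exists_coeff_of_mem_normalSet hp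
  exact ⟨σ, τ, h1, h2, h3, h4, h5, h6⟩

/-- Indices carrying a positive coefficient at `z₀` are active wherever `p` is a subgradient. -/
theorem Represents.support_subset [Fintype I] [Fintype J] [Nonempty J] {z₀ z p : E s}
    {σ : J → ℝ} {τ : I → ℝ} (hr : D.Represents z₀ p σ τ) (hz₀ : z₀ ∈ D.constraintSet)
    (hp : p ∈ subdifferential D.toFun z) :
    {i | 0 < τ i} ⊆ D.activeI z ∧ {j | 0 < σ j} ⊆ D.activeJ z := by
  have hz := D.mem_constraintSet_of_mem_subdifferential hp
  have hle := (D.mem_subdifferential_iff_of_mem hz).1 hp z₀ hz₀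
  have hσ : ∀ j, σ j * (inner ℝ (D.a j) z₀ - D.c j) = σ j * D.maxPiece z₀ := fun j => by
    by_cases hj : j ∈ D.activeJ z₀
    · rw [← (D.mem_activeJ_iff hz₀).1 hj, piece]
    · rw [hr.sigma_inactive j hj, zero_mul, zero_mul]
  have hτ : ∀ i, τ i * (inner ℝ (D.b i) z₀ - D.d i) = 0 := fun i => by
    by_cases hi : i ∈ D.activeI z₀
    · rw [show inner ℝ (D.b i) z₀ - D.d i = 0 from hi, mul_zero]
    · rw [hr.tau_inactive i hi, zero_mul]
  have hin : inner ℝ p (z₀ - z) = ∑ j, σ j * inner ℝ (D.a j) (z₀ - z)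
      + ∑ i, τ i * inner ℝ (D.b i) (z₀ - z) := by
    conv_lhs => rw [hr.eq]
    simp [inner_add_left, sum_inner, inner_smul_left]
  have e1 : ∑ j, σ j * inner ℝ (D.a j) (z₀ - z)
      = ∑ j, (σ j * (D.maxPiece z - D.piece j z) + σ j * (D.maxPiece z₀ - D.maxPiece z)) := by
    refine Finset.sum_congr rfl fun j _ => ?_
    have := hσ j
    rw [inner_sub_right, piece]
    linarith
  have e2 : ∑ i, τ i * inner ℝ (D.b i) (z₀ - z)
      = ∑ i, τ i * (D.d i - inner ℝ (D.b i) z) := by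
    refine Finset.sum_congr rfl fun i _ => ?_
    have := hτ i
    rw [inner_sub_right]
    linarith
  -- Complementary slackness: `⟨p, z₀ - z⟩` equals `maxPiece z₀ - maxPiece z` plus nonnegative
  -- slacks, and `hle` bounds it by that difference, so every slack vanishes.
  rw [Finset.sum_add_distrib, ← Finset.sum_mul, hr.sigma_sum] at e1
  have n1 : ∀ j ∈ Finset.univ, 0 ≤ σ j * (D.maxPiece z - D.piece j z) := fun j _ =>
    mul_nonneg (hr.sigma_nonneg j) (sub_nonneg.2 (D.piece_le_maxPiece j z))
  have n2 : ∀ i ∈ Finset.univ, 0 ≤ τ i * (D.d i - inner ℝ (D.b i) z) := fun i _ =>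
    mul_nonneg (hr.tau_nonneg i) (by have := hz i; linarith)
  have s1 := Finset.sum_nonneg n1
  have s2 := Finset.sum_nonneg n2
  have z1 : ∑ j, σ j * (D.maxPiece z - D.piece j z) = 0 := by linarith
  have z2 : ∑ i, τ i * (D.d i - inner ℝ (D.b i) z) = 0 := by linarith
  rw [Finset.sum_eq_zero_iff_of_nonneg n1] at z1
  rw [Finset.sum_eq_zero_iff_of_nonneg n2] at z2
  constructor
  · intro i hi
    have := (mul_eq_zero.1 (z2 i (Finset.mem_univ i))).resolve_left (ne_of_gt hi)
    change inner ℝ (D.b i) z - D.d i = 0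
    linarith
  · intro j hj
    have := (mul_eq_zero.1 (z1 j (Finset.mem_univ j))).resolve_left (ne_of_gt hj)
    rw [D.mem_activeJ_iff hz]
    linarith

theorem eventually_activeI_subset [Finite I] (z₀ : E s) :
    ∀ᶠ z in 𝓝 z₀, D.activeI z ⊆ D.activeI z₀ := by
  have : ∀ᶠ z in 𝓝 z₀, ∀ i, i ∈ D.activeI z → i ∈ D.activeI z₀ := by
    rw [Filter.eventually_all]
    intro i
    by_cases hi : i ∈ D.activeI z₀
    · exact Filter.Eventually.of_forall fun _ _ => hi
    · have hc : Continuous fun z => inner ℝ (D.b i) z - D.d i := by fun_prop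
      filter_upwards [hc.continuousAt.eventually_ne hi] with z hz hz'
      exact absurd hz' hz
  exact this

theorem eventually_activeJ_subset [Finite J] [Nonempty J] {z₀ : E s} (hz₀ : z₀ ∈ D.constraintSet) :
    ∀ᶠ z in 𝓝 z₀, z ∈ D.constraintSet → D.activeJ z ⊆ D.activeJ z₀ := by
  have : ∀ᶠ z in 𝓝 z₀, ∀ j, z ∈ D.constraintSet → j ∈ D.activeJ z → j ∈ D.activeJ z₀ := by
    rw [Filter.eventually_all]
    intro j
    by_cases hj : j ∈ D.activeJ z₀
    · exact Filter.Eventually.of_forall fun _ _ _ => hj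
    · have hc : Continuous fun z => D.piece j z - D.maxPiece z :=
        (D.continuous_piece j).sub D.continuous_maxPiece
      have hne : D.piece j z₀ - D.maxPiece z₀ ≠ 0 :=
        sub_ne_zero.2 fun h => hj ((D.mem_activeJ_iff hz₀).2 h)
      filter_upwards [hc.continuousAt.eventually_ne hne] with z hz hzC hz'
      exact absurd (sub_eq_zero.2 ((D.mem_activeJ_iff hzC).1 hz')) hz
  filter_upwards [this] with z hz hzC j hj using hz j hzC hj

end PolyData

/-- A proper epi-polyhedral function is a maximum of finitely many affine functions plus the
indicator of finitely many affine inequalities. -/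
theorem exists_polyData {s : ℕ} {h : E s → EReal} (hp : IsProper h) (hpoly : IsEpiPolyhedral h) :
    ∃ (I J : Type) (_ : Fintype I) (_ : Fintype J) (D : PolyData s I J), h = D.toFun := by
  obtain ⟨k, c, d, e, hepi⟩ := hpoly
  have hiff : ∀ z (r : ℝ), h z ≤ r ↔ ∀ l, inner ℝ (c l) z + d l * r ≤ e l := fun z r => by
    have : (z, r) ∈ epigraph h ↔ (z, r) ∈ {q : E s × ℝ | ∀ l, inner ℝ (c l) q.1 + d l * q.2 ≤ e l} := by
      rw [hepi]
    exact this
  obtain ⟨⟨z₀, hz₀⟩, hbot⟩ := hp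
  obtain ⟨r₀, hr₀⟩ : ∃ r : ℝ, h z₀ = r := ⟨(h z₀).toReal, (EReal.coe_toReal hz₀.ne (hbot z₀)).symm⟩
  -- An epigraph is closed upwards, so no half-space may bound `r` from above.
  have hd : ∀ l, d l ≤ 0 := by
    intro l
    by_contra! hl
    have h1 := (hiff z₀ (max r₀ ((e l - inner ℝ (c l) z₀ + 1) / d l))).1
      (by rw [hr₀, EReal.coe_le_coe_iff]; exact le_max_left _ _) l
    have h2 := mul_le_mul_of_nonneg_left
      (le_max_right r₀ ((e l - inner ℝ (c l) z₀ + 1) / d l)) hl.le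
    rw [mul_div_cancel₀ _ hl.ne'] at h2
    linarith
  -- Vertical half-spaces become constraints; the others, divided by `-d l`, become affine pieces.
  let D : PolyData s {l // d l = 0} {l // d l < 0} :=
    { a := fun l => (-d l)⁻¹ • c l, c := fun l => (-d l)⁻¹ * e l, b := fun l => c l, d := fun l => e l }
  -- With only vertical half-spaces, `h` would be `-∞` at `z₀`.
  have hne : Nonempty {l // d l < 0} := by
    by_contra hJ
    rw [not_nonempty_iff] at hJ
    have h0 : ∀ l, d l = 0 := fun l => (hd l).antisymm (not_lt.1 fun hl => hJ.false ⟨l, hl⟩)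
    apply hbot z₀
    rw [EReal.eq_bot_iff_forall_lt]
    intro y
    refine lt_of_le_of_lt ((hiff z₀ (y - 1)).2 fun l => ?_)
      (EReal.coe_lt_coe_iff.2 (by linarith : y - 1 < y))
    have := (hiff z₀ r₀).1 hr₀.le l
    rw [h0 l] at this ⊢
    linarith
  refine ⟨_, _, inferInstance, inferInstance, D, funext fun z => ?_⟩
  have key : ∀ r : ℝ, h z ≤ r ↔ D.toFun z ≤ r := by
    intro r
    rw [hiff, D.toFun_le_coe_iff]
    have hJ : ∀ l : {l // d l < 0},
        inner ℝ (D.a l) z - D.c l ≤ r ↔ inner ℝ (c l) z + d l * r ≤ e l := by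
      rintro ⟨l, hl⟩
      have hl' : 0 < -d l := neg_pos.2 hl
      simp only [D, inner_smul_left, RCLike.conj_to_real]
      rw [← mul_sub, inv_mul_le_iff₀ hl']
      constructor <;> intro h <;> linarith
    constructor
    · refine fun h => ⟨fun l => ?_, fun l => (hJ l).2 (h l)⟩
      have := h l
      rw [l.2] at this
      simp only [D]
      linarith
    · rintro ⟨h1, h2⟩ l
      rcases (hd l).lt_or_eq with hl | hl
      · exact (hJ ⟨l, hl⟩).1 (h2 ⟨l, hl⟩)
      · have := h1 ⟨l, hl⟩
        simp only [D] at this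
        rw [hl]
        linarith
  apply le_antisymm
  · exact EReal.le_of_forall_lt_iff_le.1 fun r hr => (key r).2 hr.le
  · exact EReal.le_of_forall_lt_iff_le.1 fun r hr => (key r).1 hr.le

/-! ### Existence of proximal points by minimization. -/

theorem tendsto_cocompact_atTop_of_quadratic_le {V : Type*} [NormedAddCommGroup V] [ProperSpace V]
    {f : V → ℝ} {c K b : ℝ} (hb : 0 < b) (hf : ∀ v, c - K * ‖v‖ + b * ‖v‖ ^ 2 ≤ f v) :
    Filter.Tendsto f (Filter.cocompact V) Filter.atTop := by
  have h1 : Filter.Tendsto (fun t : ℝ => c + t * (b * t - K)) Filter.atTop Filter.atTop := by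
    apply Filter.tendsto_atTop_add_const_left
    refine Filter.tendsto_id.atTop_mul_atTop₀ ?_
    simpa [sub_eq_add_neg] using Filter.tendsto_atTop_add_const_right _ (-K)
      (Filter.tendsto_id.const_mul_atTop hb)
  refine Filter.tendsto_atTop_mono (fun v => ?_) (h1.comp (tendsto_norm_cocompact_atTop (E := V)))
  refine le_trans (le_of_eq ?_) (hf v)
  simp only [Function.comp]
  ring

theorem nonneg_of_forall_add_mul_nonneg {A B : ℝ} (h : ∀ t, 0 < t → t ≤ 1 → 0 ≤ A + t * B) :
    0 ≤ A := by
  have hc : Filter.Tendsto (fun t : ℝ => A + t * B) (𝓝[>] 0) (𝓝 A) := by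
    have : Continuous fun t : ℝ => A + t * B := by fun_prop
    simpa using this.continuousAt.tendsto.mono_left (nhdsWithin_le_nhds (a := (0 : ℝ)))
  refine ge_of_tendsto hc ?_
  filter_upwards [Ioo_mem_nhdsGT (zero_lt_one (α := ℝ))] with t ht
  exact h t ht.1 ht.2.le

/-- The proximal mapping is everywhere defined. -/
theorem PolyData.exists_prox {s : ℕ} {I J : Type} [Finite J] [Nonempty J] (D : PolyData s I J)
    (hne : D.constraintSet.Nonempty) {α : ℝ} (hα : 0 < α) (z : E s) :
    ∃ p, p ∈ subdifferential D.toFun (z - α • p) := by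
  set F : E s → ℝ := fun w => D.maxPiece w + 1 / (2 * α) * ‖w - z‖ ^ 2 with hF
  have hFc : Continuous F := by
    have := D.continuous_maxPiece
    fun_prop
  obtain ⟨j⟩ := ‹Nonempty J›
  have hcoer : Filter.Tendsto F (Filter.cocompact (E s)) Filter.atTop := by
    -- A single affine piece minorizes the maximum, and the quadratic term dominates it.
    refine tendsto_cocompact_atTop_of_quadratic_le (c := -D.c j) (K := ‖D.a j‖ + 1 / α * ‖z‖)
      (b := 1 / (2 * α)) (by positivity) fun w => ?_
    have h1 := D.piece_le_maxPiece j w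
    have h2 : -(‖D.a j‖ * ‖w‖) ≤ inner ℝ (D.a j) w :=
      (abs_le.1 (abs_real_inner_le_norm (D.a j) w)).1
    have h3 : ‖w‖ ^ 2 - 2 * (‖w‖ * ‖z‖) ≤ ‖w - z‖ ^ 2 := by
      rw [norm_sub_sq_real]
      have := real_inner_le_norm w z
      nlinarith [sq_nonneg ‖z‖]
    have h4 := mul_le_mul_of_nonneg_left h3 (by positivity : 0 ≤ 1 / (2 * α))
    have h5 : 1 / (2 * α) * (‖w‖ ^ 2 - 2 * (‖w‖ * ‖z‖))
        = 1 / (2 * α) * ‖w‖ ^ 2 - 1 / α * ‖z‖ * ‖w‖ := by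
      field_simp
    simp only [hF]
    rw [piece] at h1
    linarith
  obtain ⟨w₁, hw₁⟩ := hne
  obtain ⟨w, hw, hmin⟩ := hFc.continuousOn.exists_isMinOn' D.isClosed_constraintSet hw₁
    (Filter.Eventually.filter_mono inf_le_left (hcoer.eventually_ge_atTop (F w₁)))
  have : Nonempty J := ⟨j⟩
  refine ⟨α⁻¹ • (z - w), ?_⟩
  have hzw : z - α • α⁻¹ • (z - w) = w := by
    rw [smul_inv_smul₀ hα.ne']; abel
  rw [hzw, D.mem_subdifferential_iff_of_mem hw]
  intro w' hw'
  -- First-order optimality: compare `w` with points of the segment to `w'`, divide by `t` and let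
  -- `t` tend to `0`.
  have key : 0 ≤ D.maxPiece w' - D.maxPiece w + 1 / α * inner ℝ (w - z) (w' - w) := by
    refine nonneg_of_forall_add_mul_nonneg (B := 1 / (2 * α) * ‖w' - w‖ ^ 2) fun t ht ht1 => ?_
    have hmem := D.convex_constraintSet hw hw' (sub_nonneg.2 ht1) ht.le (sub_add_cancel 1 t)
    have h1 : F w ≤ F ((1 - t) • w + t • w') := hmin hmem
    have h2 := D.maxPiece_combo_le w w' (sub_nonneg.2 ht1) ht.le (sub_add_cancel 1 t)
    have h3 : (1 - t) • w + t • w' - z = (w - z) + t • (w' - w) := by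
      rw [sub_smul, one_smul, smul_sub]; abel
    simp only [hF] at h1
    rw [h3, norm_add_sq_real, norm_smul, inner_smul_right, mul_pow, Real.norm_eq_abs, sq_abs] at h1
    have h4 : 1 / (2 * α) * (‖w - z‖ ^ 2 + 2 * (t * inner ℝ (w - z) (w' - w)) + t ^ 2 * ‖w' - w‖ ^ 2)
        = 1 / (2 * α) * ‖w - z‖ ^ 2
          + t * (1 / α * inner ℝ (w - z) (w' - w) + t * (1 / (2 * α) * ‖w' - w‖ ^ 2)) := by
      field_simp
      ring
    rw [h4] at h1
    have h5 : 0 ≤ t * (D.maxPiece w' - D.maxPiece w + 1 / α * inner ℝ (w - z) (w' - w)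
        + t * (1 / (2 * α) * ‖w' - w‖ ^ 2)) := by
      linarith
    exact nonneg_of_mul_nonneg_right h5 ht
  have e : inner ℝ (α⁻¹ • (z - w)) (w' - w) = -(1 / α * inner ℝ (w - z) (w' - w)) := by
    rw [inner_smul_left, ← neg_sub w z, inner_neg_left]
    simp
  rw [e]
  linarith

/-! ### Differentiability of the Moreau envelope. -/

section Envelope

variable {V : Type*} [NormedAddCommGroup V] [InnerProductSpace ℝ V] {f : V → EReal} {lam : ℝ}

theorem moreauEnvelope_eq_coe_toReal (hl : 0 < lam) {z p : V}
    (hp : p ∈ subdifferential f (z - lam • p)) :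
    moreauEnvelope lam f z = ((moreauEnvelope lam f z).toReal : EReal) := by
  obtain ⟨r, hr⟩ := exists_real_of_mem_subdifferential hp
  rw [moreauEnvelope_eq_of_mem_subdifferential hl hr hp, EReal.toReal_coe]

/-- The subgradient inequality between the two proximal points, with the term `lam/2 * ‖p - p'‖²`
dropped. -/
theorem moreauEnvelope_add_inner_le (hl : 0 < lam) {z p z' p' : V}
    (hp : p ∈ subdifferential f (z - lam • p)) (hp' : p' ∈ subdifferential f (z' - lam • p')) :
    (moreauEnvelope lam f z).toReal + inner ℝ p (z' - z) ≤ (moreauEnvelope lam f z').toReal := by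
  obtain ⟨r, hr⟩ := exists_real_of_mem_subdifferential hp
  obtain ⟨r', hr'⟩ := exists_real_of_mem_subdifferential hp'
  have h1 := (mem_subdifferential_iff_of_eq_coe hr).1 hp (z' - lam • p')
  rw [hr', EReal.coe_le_coe_iff] at h1
  rw [moreauEnvelope_eq_of_mem_subdifferential hl hr hp,
    moreauEnvelope_eq_of_mem_subdifferential hl hr' hp', EReal.toReal_coe, EReal.toReal_coe]
  have h2 : z' - lam • p' - (z - lam • p) = (z' - z) + lam • (p - p') := by
    rw [smul_sub]; abel
  rw [h2, inner_add_right, inner_smul_right, inner_sub_right p p, real_inner_self_eq_norm_sq] at h1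
  have h3 := mul_nonneg (half_pos hl).le (sq_nonneg ‖p - p'‖)
  rw [norm_sub_sq_real] at h3
  linarith

/-- The proximal point of `z` is a competitor in the infimum at `z'`. -/
theorem moreauEnvelope_le_add_inner (hl : 0 < lam) {z p z' p' : V}
    (hp : p ∈ subdifferential f (z - lam • p)) (hp' : p' ∈ subdifferential f (z' - lam • p')) :
    (moreauEnvelope lam f z').toReal ≤
      (moreauEnvelope lam f z).toReal + inner ℝ p (z' - z) + 1 / (2 * lam) * ‖z' - z‖ ^ 2 := by
  obtain ⟨r, hr⟩ := exists_real_of_mem_subdifferential hp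
  rw [moreauEnvelope_eq_of_mem_subdifferential hl hr hp, EReal.toReal_coe,
    ← EReal.coe_le_coe_iff, ← moreauEnvelope_eq_coe_toReal hl hp']
  refine (iInf_le _ (z - lam • p)).trans ?_
  rw [hr, ← EReal.coe_add, EReal.coe_le_coe_iff]
  have h2 : z - lam • p - z' = -((z' - z) + lam • p) := by abel
  rw [h2, norm_neg, norm_add_sq_real, norm_smul, mul_pow, Real.norm_eq_abs, sq_abs,
    inner_smul_right, real_inner_comm p (z' - z)]
  apply le_of_eq
  field_simp
  ring

/-- The Moreau envelope is differentiable with gradient `P`. -/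
theorem hasFDerivAt_moreauEnvelope (hl : 0 < lam) {P : V → V}
    (hP : ∀ z, P z ∈ subdifferential f (z - lam • P z)) (z : V) :
    HasFDerivAt (fun z => (moreauEnvelope lam f z).toReal) (innerSL ℝ (P z)) z := by
  have h0 : HasFDerivAt (fun z' => (moreauEnvelope lam f z').toReal
      - (moreauEnvelope lam f z).toReal - inner ℝ (P z) (z' - z)) (0 : V →L[ℝ] ℝ) z := by
    -- The remainder lies between `0` and `‖z' - z‖² / (2 lam)`.
    refine Asymptotics.IsBigO.hasFDerivAt (n := 2) ?_ one_lt_two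
    refine Asymptotics.IsBigO.of_bound (1 / (2 * lam)) (Filter.Eventually.of_forall fun z' => ?_)
    have h1 := moreauEnvelope_add_inner_le hl (hP z) (hP z')
    have h2 := moreauEnvelope_le_add_inner hl (hP z) (hP z')
    rw [Real.norm_eq_abs, abs_of_nonneg (by linarith), Real.norm_eq_abs,
      abs_of_nonneg (by positivity)]
    linarith
  have h1 : HasFDerivAt (fun z' => (moreauEnvelope lam f z).toReal + inner ℝ (P z) (z' - z))
      (innerSL ℝ (P z)) z := by
    refine HasFDerivAt.const_add _ ?_
    exact (innerSL ℝ (P z)).hasFDerivAt.comp z ((hasFDerivAt_id z).sub_const z)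
  have := h0.add h1
  rw [zero_add] at this
  exact this.congr_of_eventuallyEq (Filter.Eventually.of_forall fun z' => by
    simp only [Pi.add_apply]; ring)

end Envelope

/-! ### Minimizers of the regularized objective. -/

section Existence

variable {n m s : ℕ} {g : E n → E m → ℝ} {G : E n → E m → E s} {h : E s → EReal} {α β : ℝ}

theorem add_inner_gradient_le {x : E n} (hg : Differentiable ℝ (g x))
    (hconv : ConvexOn ℝ Set.univ (g x)) (y y' : E m) :
    g x y + inner ℝ (gradient (g x) y) (y' - y) ≤ g x y' := by
  have := hconv.add_fderiv_le (hg y).hasGradientAt.hasFDerivAt y'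
  simpa using this

/-- The tangent inequality for each component, weighted by `p i ≥ 0`. -/
theorem inner_adjoint_fderiv_le {x : E n} (hG : Differentiable ℝ (G x))
    (hconv : ∀ i, ConvexOn ℝ Set.univ fun y => G x y i) {p : E s} (hp : ∀ i, 0 ≤ p i)
    (y y' : E m) :
    inner ℝ (ContinuousLinearMap.adjoint (fderiv ℝ (G x) y) p) (y' - y) ≤
      inner ℝ p (G x y' - G x y) := by
  rw [ContinuousLinearMap.adjoint_inner_left]
  simp only [PiLp.inner_apply]
  refine Finset.sum_le_sum fun i _ => ?_
  have hd : HasFDerivAt (fun y => G x y i)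
      ((EuclideanSpace.proj (𝕜 := ℝ) i).comp (fderiv ℝ (G x) y)) y :=
    (EuclideanSpace.proj (𝕜 := ℝ) i).hasFDerivAt.comp y (hG y).hasFDerivAt
  have := (hconv i).add_fderiv_le hd y'
  change G x y i + (fderiv ℝ (G x) y (y' - y)) i ≤ G x y' i at this
  have h2 := mul_le_mul_of_nonneg_right (by linarith :
    (fderiv ℝ (G x) y (y' - y)) i ≤ G x y' i - G x y i) (hp i)
  simpa using h2

/-- The objective function of the regularized lower-level problem. -/
def regObjective (g : E n → E m → ℝ) (G : E n → E m → E s) (h : E s → EReal) (α β : ℝ)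
    (x : E n) (y : E m) : ℝ :=
  g x y + (moreauEnvelope α h (G x y)).toReal + β / 2 * ‖y‖ ^ 2

variable {P : E s → E s}

theorem mem_regArgmin_iff (hα : 0 < α) (hP : ∀ z, P z ∈ subdifferential h (z - α • P z))
    {x : E n} {y : E m} :
    y ∈ regArgmin g G h α β x ↔
      ∀ y', regObjective g G h α β x y ≤ regObjective g G h α β x y' := by
  have hcoe : ∀ y, (g x y : EReal) + moreauEnvelope α h (G x y) + ((β / 2 * ‖y‖ ^ 2 : ℝ) : EReal)
      = (regObjective g G h α β x y : EReal) := fun y => by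
    rw [moreauEnvelope_eq_coe_toReal hα (hP (G x y)), regObjective, EReal.coe_add, EReal.coe_add]
  simp only [regArgmin, argmin, hcoe, EReal.coe_le_coe_iff]
  exact ⟨fun hy => hy.2, fun hy => ⟨EReal.coe_lt_top _, hy⟩⟩

theorem hasFDerivAt_regObjective (hα : 0 < α) (hP : ∀ z, P z ∈ subdifferential h (z - α • P z))
    {x : E n} (hg : Differentiable ℝ (g x)) (hG : Differentiable ℝ (G x)) (y : E m) :
    HasFDerivAt (regObjective g G h α β x) (innerSL ℝ (lagrGrad g G β x y (P (G x y)))) y := by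
  have h1 := (hg y).hasGradientAt.hasFDerivAt
  have h2 := (hasFDerivAt_moreauEnvelope hα hP (G x y)).comp y (hG y).hasFDerivAt
  have h3 : HasFDerivAt (fun y : E m => ‖y‖ ^ 2) (2 • innerSL ℝ y) y :=
    (hasStrictFDerivAt_norm_sq y).hasFDerivAt
  refine ((h1.add h2).add (h3.const_mul (β / 2))).congr_fderiv ?_
  ext v
  simp [lagrGrad, ContinuousLinearMap.adjoint_inner_left]
  ring

theorem lagrGrad_eq_zero_of_isMin (hα : 0 < α) (hP : ∀ z, P z ∈ subdifferential h (z - α • P z))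
    {x : E n} (hg : Differentiable ℝ (g x)) (hG : Differentiable ℝ (G x)) {y : E m}
    (hy : ∀ y', regObjective g G h α β x y ≤ regObjective g G h α β x y') :
    lagrGrad g G β x y (P (G x y)) = 0 := by
  have hmin : IsLocalMin (regObjective g G h α β x) y := Filter.Eventually.of_forall hy
  have h0 := hmin.hasFDerivAt_eq_zero (hasFDerivAt_regObjective hα hP hg hG y)
  have := congrArg (fun l => l (lagrGrad g G β x y (P (G x y)))) h0
  simpa using this

/-- Linearizing `g`, `G` and the envelope at `y = 0` bounds the objective below by an affine
function plus `β/2 * ‖y‖²`, whence coercivity. -/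
theorem exists_forall_regObjective_le (hα : 0 < α) (hβ : 0 < β)
    (hP : ∀ z, P z ∈ subdifferential h (z - α • P z)) (hm : IsNondecreasing h)
    {x : E n} (hg : Differentiable ℝ (g x)) (hG : Differentiable ℝ (G x))
    (hgc : ConvexOn ℝ Set.univ (g x)) (hGc : ∀ i, ConvexOn ℝ Set.univ fun y => G x y i) :
    ∃ y, ∀ y', regObjective g G h α β x y ≤ regObjective g G h α β x y' := by
  have hcont : Continuous (regObjective g G h α β x) :=
    continuous_iff_continuousAt.2 fun y => (hasFDerivAt_regObjective hα hP hg hG y).continuousAt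
  set p := P (G x 0)
  set v := gradient (g x) 0 + ContinuousLinearMap.adjoint (fderiv ℝ (G x) 0) p with hv
  refine hcont.exists_forall_le (tendsto_cocompact_atTop_of_quadratic_le
    (c := g x 0 + (moreauEnvelope α h (G x 0)).toReal) (K := ‖v‖) (half_pos hβ) fun y => ?_)
  have h1 := add_inner_gradient_le hg hgc 0 y
  have h2 := inner_adjoint_fderiv_le hG hGc
    (nonneg_of_mem_subdifferential hm (hP (G x 0))) 0 y
  have h3 := moreauEnvelope_add_inner_le hα (hP (G x 0)) (hP (G x y))
  have h4 : -(‖v‖ * ‖y‖) ≤ inner ℝ v y := (abs_le.1 (abs_real_inner_le_norm v y)).1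
  rw [hv, inner_add_left, ← hv] at h4
  rw [sub_zero] at h1 h2
  rw [regObjective]
  linarith

end Existence

/-! ### Smoothness of the data of the system. -/

section Smooth

variable {n m s : ℕ} {g : E n → E m → ℝ} {G : E n → E m → E s}

theorem contDiff_of_coord (hG : ∀ i, ContDiff ℝ 2 fun q : E n × E m => G q.1 q.2 i) :
    ContDiff ℝ 2 fun q : E n × E m => G q.1 q.2 :=
  contDiff_euclidean.2 hG

theorem isBoundedLinearMap_toDual_symm :
    IsBoundedLinearMap ℝ fun l : StrongDual ℝ (E m) => (InnerProductSpace.toDual ℝ (E m)).symm l :=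
  .mk (.mk (fun _ _ => map_add _ _ _) fun c l => by simp) ⟨1, one_pos, fun l => by simp⟩

theorem isBoundedLinearMap_adjoint :
    IsBoundedLinearMap ℝ fun A : E m →L[ℝ] E s => ContinuousLinearMap.adjoint A :=
  .mk (.mk (fun _ _ => map_add _ _ _) fun c l => by simp) ⟨1, one_pos, fun l => by simp⟩

theorem contDiff_lagrGrad (hg : ContDiff ℝ 2 fun q : E n × E m => g q.1 q.2)
    (hG : ContDiff ℝ 2 fun q : E n × E m => G q.1 q.2) (β : ℝ) :
    ContDiff ℝ 1 fun u : E n × PD m s => lagrGrad g G β u.1 u.2.fst u.2.snd := by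
  have hfst : ContDiff ℝ 1 fun u : E n × PD m s => u.2.fst :=
    (WithLp.fstL 2 ℝ (E m) (E s)).contDiff.comp contDiff_snd
  have hsnd : ContDiff ℝ 1 fun u : E n × PD m s => u.2.snd :=
    (WithLp.sndL 2 ℝ (E m) (E s)).contDiff.comp contDiff_snd
  have e1 : ContDiff ℝ 1 fun u : E n × PD m s => fderiv ℝ (g u.1) u.2.fst :=
    ContDiff.fderiv (f := fun (u : E n × PD m s) y => g u.1 y) (m := 2)
      (hg.comp (g := fun q : E n × E m => g q.1 q.2)
        (f := fun v : (E n × PD m s) × E m => (v.1.1, v.2)) (by fun_prop)) hfst one_add_one_eq_two.le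
  have e2 : ContDiff ℝ 1 fun u : E n × PD m s => fderiv ℝ (G u.1) u.2.fst :=
    ContDiff.fderiv (f := fun (u : E n × PD m s) y => G u.1 y) (m := 2)
      (hG.comp (g := fun q : E n × E m => G q.1 q.2)
        (f := fun v : (E n × PD m s) × E m => (v.1.1, v.2)) (by fun_prop)) hfst one_add_one_eq_two.le
  exact ((isBoundedLinearMap_toDual_symm.contDiff.comp e1).add
    ((isBoundedLinearMap_adjoint.contDiff.comp e2).clm_apply hsnd)).add (hfst.const_smul β)

theorem contDiff_shifted (hG : ContDiff ℝ 2 fun q : E n × E m => G q.1 q.2) (α : ℝ) :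
    ContDiff ℝ 1 fun u : E n × PD m s => shifted G α u.1 u.2 := by
  have h1 : ContDiff ℝ 1 fun u : E n × PD m s => G u.1 u.2.fst :=
    (hG.of_le one_le_two).comp (g := fun q : E n × E m => G q.1 q.2)
      (f := fun u : E n × PD m s => (u.1, u.2.fst))
      (contDiff_fst.prodMk ((WithLp.fstL 2 ℝ (E m) (E s)).contDiff.comp contDiff_snd))
  have h2 : ContDiff ℝ 1 fun u : E n × PD m s => u.2.snd :=
    (WithLp.sndL 2 ℝ (E m) (E s)).contDiff.comp contDiff_snd
  exact h1.sub (h2.const_smul α)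

theorem differentiable_section (hg : ContDiff ℝ 2 fun q : E n × E m => g q.1 q.2) (x : E n) :
    Differentiable ℝ (g x) :=
  (hg.differentiable two_ne_zero).comp (g := fun q : E n × E m => g q.1 q.2)
    (f := fun y => (x, y)) (by fun_prop)

theorem differentiable_section_vec (hG : ContDiff ℝ 2 fun q : E n × E m => G q.1 q.2) (x : E n) :
    Differentiable ℝ (G x) :=
  (hG.differentiable two_ne_zero).comp (g := fun q : E n × E m => G q.1 q.2)
    (f := fun y => (x, y)) (by fun_prop)

end Smooth

/-! ### Strong monotonicity, uniqueness and continuity. -/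

section Monotone

variable {n m s : ℕ} {g : E n → E m → ℝ} {G : E n → E m → E s} {h : E s → EReal} {α β : ℝ}

/-- The primal-dual mapping is monotone on nonnegative multipliers, strongly so in `y`. -/
theorem lagrGrad_strongly_monotone {x : E n} (hg : Differentiable ℝ (g x))
    (hG : Differentiable ℝ (G x)) (hgc : ConvexOn ℝ Set.univ (g x))
    (hGc : ∀ i, ConvexOn ℝ Set.univ fun y => G x y i) {p p' : E s} (hp : ∀ i, 0 ≤ p i)
    (hp' : ∀ i, 0 ≤ p' i) (y y' : E m) :
    β * ‖y - y'‖ ^ 2 ≤ inner ℝ (lagrGrad g G β x y p - lagrGrad g G β x y' p') (y - y')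
      - inner ℝ (G x y - G x y') (p - p') := by
  have h1 := add_inner_gradient_le hg hgc y y'
  have h2 := add_inner_gradient_le hg hgc y' y
  have h3 := inner_adjoint_fderiv_le hG hGc hp y y'
  have h4 := inner_adjoint_fderiv_le hG hGc hp' y' y
  rw [← neg_sub y y', inner_neg_right] at h1 h3
  rw [← neg_sub (G x y) (G x y'), inner_neg_right] at h3
  have e : inner ℝ (lagrGrad g G β x y p - lagrGrad g G β x y' p') (y - y')
      = inner ℝ (gradient (g x) y) (y - y') - inner ℝ (gradient (g x) y') (y - y')
        + inner ℝ (ContinuousLinearMap.adjoint (fderiv ℝ (G x) y) p) (y - y')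
        - inner ℝ (ContinuousLinearMap.adjoint (fderiv ℝ (G x) y') p') (y - y')
        + β * ‖y - y'‖ ^ 2 := by
    have : lagrGrad g G β x y p - lagrGrad g G β x y' p'
        = gradient (g x) y - gradient (g x) y'
          + ContinuousLinearMap.adjoint (fderiv ℝ (G x) y) p
          - ContinuousLinearMap.adjoint (fderiv ℝ (G x) y') p' + β • (y - y') := by
      simp only [lagrGrad, smul_sub]; abel
    rw [this, inner_add_left, inner_sub_left, inner_add_left, inner_sub_left, inner_smul_left,
      real_inner_self_eq_norm_sq]
    simp
  rw [e, inner_sub_right (G x y - G x y'), real_inner_comm p, real_inner_comm p']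
  linarith

/-- Quantitative stability of primal-dual solutions under perturbation of the parameter. -/
theorem norm_sub_le_of_mem_solSet (hh : IsProper h) (hm : IsNondecreasing h) {x x₀ : E n}
    (hg : Differentiable ℝ (g x)) (hG : Differentiable ℝ (G x))
    (hgc : ConvexOn ℝ Set.univ (g x)) (hGc : ∀ i, ConvexOn ℝ Set.univ fun y => G x y i)
    {q q₀ : PD m s} (hq : q ∈ solSet g G h α β x) (hq₀ : q₀ ∈ solSet g G h α β x₀) :
    min α β * ‖q - q₀‖ ≤ ‖lagrGrad g G β x q₀.fst q₀.snd‖ + ‖G x q₀.fst - G x₀ q₀.fst‖ := by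
  rw [mem_solSet_iff] at hq hq₀
  have h1 := lagrGrad_strongly_monotone (β := β) hg hG hgc hGc
    (nonneg_of_conjugate_ne_top hh hm hq.2.1) (nonneg_of_conjugate_ne_top hh hm hq₀.2.1)
    q.fst q₀.fst
  -- Added to `h1`, this cancels the cross term `⟨G x y - G x y₀, p - p₀⟩` and contributes `α‖p -
  -- p₀‖²`; only residuals of `q₀` at the parameter `x` remain.
  have h2 := subdifferential_monotone hq.2 hq₀.2
  have e : shifted G α x q - shifted G α x₀ q₀
      = (G x q.fst - G x q₀.fst) + (G x q₀.fst - G x₀ q₀.fst) - α • (q.snd - q₀.snd) := by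
    simp only [shifted, smul_sub]; abel
  rw [e, inner_sub_left, inner_add_left, inner_smul_left, real_inner_self_eq_norm_sq,
    RCLike.conj_to_real] at h2
  rw [hq.1, zero_sub, inner_neg_left] at h1
  have n0 : ‖q - q₀‖ ^ 2 = ‖q.fst - q₀.fst‖ ^ 2 + ‖q.snd - q₀.snd‖ ^ 2 :=
    WithLp.prod_norm_sq_eq_of_L2 (q - q₀)
  have n1 : ‖q.fst - q₀.fst‖ ≤ ‖q - q₀‖ :=
    abs_le_of_sq_le_sq' (by nlinarith [sq_nonneg ‖q.snd - q₀.snd‖]) (norm_nonneg _) |>.2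
  have n2 : ‖q.snd - q₀.snd‖ ≤ ‖q - q₀‖ :=
    abs_le_of_sq_le_sq' (by nlinarith [sq_nonneg ‖q.fst - q₀.fst‖]) (norm_nonneg _) |>.2
  have i1 := (abs_le.1 (abs_real_inner_le_norm (lagrGrad g G β x q₀.fst q₀.snd)
    (q.fst - q₀.fst))).1
  have i2 := real_inner_le_norm (G x q₀.fst - G x₀ q₀.fst) (q.snd - q₀.snd)
  have m1 := mul_le_mul_of_nonneg_left n1 (norm_nonneg (lagrGrad g G β x q₀.fst q₀.snd))
  have m2 := mul_le_mul_of_nonneg_left n2 (norm_nonneg (G x q₀.fst - G x₀ q₀.fst))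
  have k1 := mul_le_mul_of_nonneg_right (min_le_left α β) (sq_nonneg ‖q.snd - q₀.snd‖)
  have k2 := mul_le_mul_of_nonneg_right (min_le_right α β) (sq_nonneg ‖q.fst - q₀.fst‖)
  have key : min α β * ‖q - q₀‖ ^ 2 ≤
      (‖lagrGrad g G β x q₀.fst q₀.snd‖ + ‖G x q₀.fst - G x₀ q₀.fst‖) * ‖q - q₀‖ := by
    rw [n0, mul_add, add_mul]
    linarith
  rcases (norm_nonneg (q - q₀)).eq_or_lt with h0 | h0
  · rw [← h0, mul_zero]; positivity
  · rw [sq, ← mul_assoc] at key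
    exact le_of_mul_le_mul_right key h0

theorem subsingleton_solSet (hα : 0 < α) (hβ : 0 < β) (hh : IsProper h) (hm : IsNondecreasing h)
    {x : E n} (hg : Differentiable ℝ (g x)) (hG : Differentiable ℝ (G x))
    (hgc : ConvexOn ℝ Set.univ (g x)) (hGc : ∀ i, ConvexOn ℝ Set.univ fun y => G x y i) :
    (solSet g G h α β x).Subsingleton := by
  intro q hq q₀ hq₀
  have := norm_sub_le_of_mem_solSet hh hm hg hG hgc hGc hq hq₀
  rw [(mem_solSet_iff.1 hq₀).1, sub_self, norm_zero, norm_zero, add_zero] at this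
  have h0 : ‖q - q₀‖ ≤ 0 := nonpos_of_mul_nonpos_right this (lt_min hα hβ)
  exact sub_eq_zero.1 (norm_le_zero_iff.1 h0)

theorem continuous_of_mem_solSet (hα : 0 < α) (hβ : 0 < β) (hh : IsProper h)
    (hm : IsNondecreasing h) (hg : ContDiff ℝ 2 fun q : E n × E m => g q.1 q.2)
    (hG : ContDiff ℝ 2 fun q : E n × E m => G q.1 q.2)
    (hgc : ∀ x, ConvexOn ℝ Set.univ (g x)) (hGc : ∀ i x, ConvexOn ℝ Set.univ fun y => G x y i)
    {S : E n → PD m s} (hS : ∀ x, S x ∈ solSet g G h α β x) : Continuous S := by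
  rw [continuous_iff_continuousAt]
  intro x₀
  have hmin := lt_min hα hβ
  have c1 : Continuous fun x => lagrGrad g G β x (S x₀).fst (S x₀).snd :=
    (contDiff_lagrGrad hg hG β).continuous.comp (f := fun x => (x, S x₀)) (by fun_prop)
  have c2 : Continuous fun x => G x (S x₀).fst :=
    hG.continuous.comp (f := fun x => (x, (S x₀).fst)) (by fun_prop)
  have c3 : Continuous fun x => (min α β)⁻¹ *
      (‖lagrGrad g G β x (S x₀).fst (S x₀).snd‖ + ‖G x (S x₀).fst - G x₀ (S x₀).fst‖) := by
    fun_prop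
  have h0 := c3.tendsto x₀
  rw [(mem_solSet_iff.1 (hS x₀)).1, sub_self, norm_zero, norm_zero, add_zero, mul_zero] at h0
  refine tendsto_iff_norm_sub_tendsto_zero.2 (squeeze_zero (fun _ => norm_nonneg _) (fun x => ?_) h0)
  rw [le_inv_mul_iff₀ hmin]
  exact norm_sub_le_of_mem_solSet hh hm (differentiable_section hg x)
    (differentiable_section_vec hG x) (hgc x) (fun i => hGc i x) (hS x) (hS x₀)

end Monotone

/-! ### Existence and uniqueness of the primal-dual solution. -/

section SolutionMap

variable {n m s : ℕ} {g : E n → E m → ℝ} {G : E n → E m → E s} {h : E s → EReal} {α β : ℝ}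

/-- Each minimizer yields a primal-dual solution, so uniqueness of solutions makes the minimizer
unique too. The last conclusion, a subgradient of `h` rather than of `h*`, is read off the proximal
construction. -/
theorem exists_solution (hα : 0 < α) (hβ : 0 < β) (hh : IsProper h) (hpoly : IsEpiPolyhedral h)
    (hm : IsNondecreasing h) {x : E n} (hg : Differentiable ℝ (g x)) (hG : Differentiable ℝ (G x))
    (hgc : ConvexOn ℝ Set.univ (g x)) (hGc : ∀ i, ConvexOn ℝ Set.univ fun y => G x y i) :
    ∃ q : PD m s, solSet g G h α β x = {q} ∧ regArgmin g G h α β x = {q.fst} ∧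
      q.snd ∈ subdifferential h (shifted G α x q) := by
  obtain ⟨I, J, _, _, D, rfl⟩ := exists_polyData hh hpoly
  have := D.nonempty_of_isProper hh
  have hne : D.constraintSet.Nonempty := by
    obtain ⟨⟨z, hz⟩, -⟩ := hh
    refine ⟨z, ?_⟩
    by_contra hz'
    exact hz.ne (D.toFun_of_notMem hz')
  choose P hP using D.exists_prox hne hα
  have hsol : ∀ y, (∀ y', regObjective g G D.toFun α β x y ≤ regObjective g G D.toFun α β x y') →
      WithLp.toLp 2 (y, P (G x y)) ∈ solSet g G D.toFun α β x := fun y hy =>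
    mem_solSet_iff.2 ⟨lagrGrad_eq_zero_of_isMin hα hP hg hG hy,
      mem_subdifferential_conjugate (hP (G x y))⟩
  have hsub := subsingleton_solSet hα hβ hh hm hg hG hgc hGc
  obtain ⟨y, hy⟩ := exists_forall_regObjective_le hα hβ hP hm hg hG hgc hGc
  refine ⟨WithLp.toLp 2 (y, P (G x y)), hsub.eq_singleton_of_mem (hsol y hy), ?_, hP (G x y)⟩
  refine Set.eq_singleton_iff_unique_mem.2 ⟨(mem_regArgmin_iff hα hP).2 hy, fun y' hy' => ?_⟩
  have := hsub (hsol y' ((mem_regArgmin_iff hα hP).1 hy')) (hsol y hy)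
  exact congrArg WithLp.fst this

end SolutionMap

/-! ### Reduced functions: one affine piece on an affine set. -/

namespace PolyData

variable {s : ℕ} {I J : Type} (D : PolyData s I J)

/-- The directions along which the pieces in `J'` vary equally and the constraints in `I'` are
constant. -/
def direction (I' : Set I) (J' : Set J) : Submodule ℝ (E s) where
  carrier := {w | (∀ j ∈ J', ∀ k ∈ J', inner ℝ (D.a j) w = inner ℝ (D.a k) w) ∧
    ∀ i ∈ I', inner ℝ (D.b i) w = 0}
  add_mem' {v w} hv hw := by
    refine ⟨fun j hj k hk => ?_, fun i hi => ?_⟩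
    · rw [inner_add_right, inner_add_right, hv.1 j hj k hk, hw.1 j hj k hk]
    · rw [inner_add_right, hv.2 i hi, hw.2 i hi, add_zero]
  zero_mem' := by simp
  smul_mem' c w hw := by
    refine ⟨fun j hj k hk => ?_, fun i hi => ?_⟩
    · rw [inner_smul_right, inner_smul_right, hw.1 j hj k hk]
    · rw [inner_smul_right, hw.2 i hi, mul_zero]

/-- The affine set on which all pieces in `J'` agree with the piece `j₀` and all constraints in
`I'` are equalities. -/
def face (I' : Set I) (J' : Set J) (j₀ : J) : Set (E s) :=
  {z | (∀ j ∈ J', inner ℝ (D.a j) z - D.c j = inner ℝ (D.a j₀) z - D.c j₀) ∧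
    ∀ i ∈ I', inner ℝ (D.b i) z - D.d i = 0}

variable {D} {I' : Set I} {J' : Set J} {j₀ : J}

theorem reduced_of_mem {z : E s} (hz : z ∈ D.face I' J' j₀) :
    D.reduced I' J' j₀ z = (D.piece j₀ z : EReal) := by
  change ((D.piece j₀ z : ℝ) : EReal) + indicatorFun (D.face I' J' j₀) z = _
  rw [indicatorFun, if_pos hz, add_zero]

theorem reduced_of_notMem {z : E s} (hz : z ∉ D.face I' J' j₀) : D.reduced I' J' j₀ z = ⊤ := by
  change ((D.piece j₀ z : ℝ) : EReal) + indicatorFun (D.face I' J' j₀) z = _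
  rw [indicatorFun, if_neg hz]
  exact EReal.coe_add_top _

theorem mem_face_iff (hj₀ : j₀ ∈ J') {z₀ z : E s} (hz₀ : z₀ ∈ D.face I' J' j₀) :
    z ∈ D.face I' J' j₀ ↔ z - z₀ ∈ D.direction I' J' := by
  constructor
  · intro hz
    refine ⟨fun j hj k hk => ?_, fun i hi => ?_⟩
    · have h1 := hz.1 j hj
      have h2 := hz.1 k hk
      have h3 := hz₀.1 j hj
      have h4 := hz₀.1 k hk
      simp only [inner_sub_right]
      linarith
    · have h1 := hz.2 i hi
      have h2 := hz₀.2 i hi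
      rw [inner_sub_right]
      linarith
  · intro hw
    refine ⟨fun j hj => ?_, fun i hi => ?_⟩
    · have h1 := hw.1 j hj j₀ hj₀
      have h2 := hz₀.1 j hj
      simp only [inner_sub_right] at h1
      linarith
    · have h1 := hw.2 i hi
      have h2 := hz₀.2 i hi
      rw [inner_sub_right] at h1
      linarith

/-- With `M` the direction space, the conjugate is finite only on `a j₀ + Mᗮ` and affine with slope
`z₀` there, so its subdifferential is `z₀ + M`. -/
theorem mem_subdifferential_conjugate_reduced_iff (hj₀ : j₀ ∈ J') {z₀ : E s}
    (hz₀ : z₀ ∈ D.face I' J' j₀) {z p : E s} :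
    z ∈ subdifferential (conjugate (D.reduced I' J' j₀)) p ↔
      p - D.a j₀ ∈ (D.direction I' J')ᗮ ∧ z - z₀ ∈ D.direction I' J' := by
  constructor
  · intro hz
    obtain ⟨ρ, hρ⟩ := exists_real_of_mem_subdifferential hz
    have hbound : ∀ w ∈ D.face I' J' j₀, inner ℝ p w - D.piece j₀ w ≤ ρ := fun w hw => by
      rw [← EReal.coe_le_coe_iff, ← hρ]
      refine le_trans ?_ (le_iSup _ w)
      rw [reduced_of_mem hw, EReal.coe_sub]
    constructor
    · rw [Submodule.mem_orthogonal']
      intro w hw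
      by_contra hne
      set γ := inner ℝ (p - D.a j₀) w with hγ
      -- Chosen so that the value at `z₀ + t • w` is `ρ + 1`, above the supremum.
      set t := (ρ - (inner ℝ p z₀ - D.piece j₀ z₀) + 1) / γ
      have hmem : z₀ + t • w ∈ D.face I' J' j₀ := by
        rw [mem_face_iff hj₀ hz₀, add_sub_cancel_left]
        exact Submodule.smul_mem _ _ hw
      have h1 := hbound _ hmem
      have h2 : t * γ = ρ - (inner ℝ p z₀ - D.piece j₀ z₀) + 1 := div_mul_cancel₀ _ hne
      rw [hγ, inner_sub_left, mul_sub] at h2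
      rw [piece_add, inner_add_right, inner_smul_right, inner_smul_right] at h1
      linarith
    · rw [← Submodule.orthogonal_orthogonal (D.direction I' J'), Submodule.mem_orthogonal]
      have hle : ∀ u ∈ (D.direction I' J')ᗮ, inner ℝ u (z - z₀) ≤ 0 := fun u hu => by
        have h1 := (mem_subdifferential_iff_of_eq_coe hρ).1 hz (p + u)
        -- Since `u ∈ Mᗮ`, the functional `⟨u, ·⟩` is constant on the face.
        have h2 : conjugate (D.reduced I' J' j₀) (p + u) ≤ ((ρ + inner ℝ u z₀ : ℝ) : EReal) := by
          refine iSup_le fun w => ?_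
          by_cases hw : w ∈ D.face I' J' j₀
          · rw [reduced_of_mem hw, ← EReal.coe_sub, EReal.coe_le_coe_iff]
            have h3 := hbound w hw
            have h4 := Submodule.inner_left_of_mem_orthogonal ((mem_face_iff hj₀ hz₀).1 hw) hu
            rw [inner_sub_right] at h4
            rw [inner_add_left]
            linarith
          · rw [reduced_of_notMem hw, EReal.sub_top]
            exact bot_le
        have h3 := EReal.coe_le_coe_iff.1 (h1.trans h2)
        rw [add_sub_cancel_left, real_inner_comm] at h3
        rw [inner_sub_right]
        linarith
      intro u hu
      have h1 := hle u hu
      have h2 := hle (-u) (Submodule.neg_mem _ hu)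
      rw [inner_neg_left] at h2
      linarith
  · rintro ⟨hp, hz⟩
    have hzf := (mem_face_iff hj₀ hz₀).2 hz
    apply mem_subdifferential_conjugate
    rw [mem_subdifferential_iff_of_eq_coe (reduced_of_mem hzf)]
    intro w
    by_cases hw : w ∈ D.face I' J' j₀
    · rw [reduced_of_mem hw, EReal.coe_le_coe_iff]
      have h1 := Submodule.inner_left_of_mem_orthogonal ((mem_face_iff hj₀ hzf).1 hw) hp
      have h2 := D.piece_add j₀ z (w - z)
      rw [add_sub_cancel] at h2
      rw [inner_sub_left] at h1
      linarith
    · rw [reduced_of_notMem hw]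
      exact le_top

theorem sub_mem_orthogonal_of_mem_normalSet (hj₀ : j₀ ∈ J') {p : E s}
    (hp : p ∈ D.normalSet I' J') : p - D.a j₀ ∈ (D.direction I' J')ᗮ := by
  rw [Submodule.mem_orthogonal']
  have hle : ∀ w ∈ D.direction I' J', inner ℝ (p - D.a j₀) w ≤ 0 := fun w hw => by
    obtain ⟨j, hj, h⟩ := hp w fun i hi => (hw.2 i hi).le
    rw [hw.1 j hj j₀ hj₀] at h
    rw [inner_sub_left]
    linarith
  intro w hw
  have h1 := hle w hw
  have h2 := hle (-w) (Submodule.neg_mem _ hw)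
  rw [inner_neg_right] at h2
  linarith

/-- Admissibility puts the supports of `σ` and `τ` inside `J'` and `I'`; along the direction space
those `a j` agree and those `b i` vanish. -/
theorem Represents.sub_mem_orthogonal [Fintype I] [Fintype J] {z p : E s} {σ : J → ℝ} {τ : I → ℝ}
    (hr : D.Represents z p σ τ) (hadm : D.Admissible z σ τ I' J') (hj₀ : j₀ ∈ J') :
    p - D.a j₀ ∈ (D.direction I' J')ᗮ := by
  rw [Submodule.mem_orthogonal']
  intro w hw
  have h1 : ∀ j, σ j * inner ℝ (D.a j) w = σ j * inner ℝ (D.a j₀) w := fun j => by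
    rcases (hr.sigma_nonneg j).eq_or_lt with h | h
    · rw [← h, zero_mul, zero_mul]
    · rw [hw.1 j (hadm.2.2.1 h) j₀ hj₀]
  have h2 : ∀ i, τ i * inner ℝ (D.b i) w = 0 := fun i => by
    rcases (hr.tau_nonneg i).eq_or_lt with h | h
    · rw [← h, zero_mul]
    · rw [hw.2 i (hadm.1 h), mul_zero]
  rw [inner_sub_left, hr.eq]
  simp only [inner_add_left, sum_inner, inner_smul_left, RCLike.conj_to_real, h1, h2]
  rw [← Finset.sum_mul, hr.sigma_sum]
  simp

theorem Admissible.mem_face [Finite J] [Nonempty J] {z : E s} {σ : J → ℝ} {τ : I → ℝ}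
    (hadm : D.Admissible z σ τ I' J') (hz : z ∈ D.constraintSet) (hj₀ : j₀ ∈ J') :
    z ∈ D.face I' J' j₀ := by
  refine ⟨fun j hj => ?_, fun i hi => hadm.2.1 hi⟩
  change D.piece j z = D.piece j₀ z
  rw [(D.mem_activeJ_iff hz).1 (hadm.2.2.2 hj), (D.mem_activeJ_iff hz).1 (hadm.2.2.2 hj₀)]

end PolyData

/-! ### Implicit functions and coercive derivatives. -/

section ImplicitFunction

/-- A version of the implicit function theorem for equations with injective partial derivative. -/
theorem exists_implicitFunction {X Y : Type*} [NormedAddCommGroup X] [NormedSpace ℝ X]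
    [CompleteSpace X] [NormedAddCommGroup Y] [NormedSpace ℝ Y] [FiniteDimensional ℝ Y]
    {F : X × Y → Y} (hF : ContDiff ℝ 1 F) {x₀ : X} {y₀ : Y} (h0 : F (x₀, y₀) = 0)
    {L : Y →L[ℝ] Y} (hL : HasFDerivAt (fun y => F (x₀, y)) L y₀) (hinj : ∀ v, L v = 0 → v = 0) :
    ∃ φ : X → Y, φ x₀ = y₀ ∧ ContDiffAt ℝ 1 φ x₀ ∧
      ∀ᶠ u in 𝓝 (x₀, y₀), F u = 0 ↔ φ u.1 = u.2 := by
  have := FiniteDimensional.complete ℝ Y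
  set A := fderiv ℝ F (x₀, y₀) ∘L .inr ℝ X Y with hA
  have hAL : A = L :=
    ((hF.differentiable one_ne_zero (x₀, y₀)).hasFDerivAt.comp y₀
      (hasFDerivAt_prodMk_right x₀ y₀)).unique hL
  have hAinj : Function.Injective A.toLinearMap := by
    rw [← LinearMap.ker_eq_bot, LinearMap.ker_eq_bot']
    intro v hv
    exact hinj v (hAL ▸ hv)
  have hinv : A.IsInvertible := by
    refine ⟨(LinearEquiv.ofInjectiveEndo A.toLinearMap hAinj).toContinuousLinearEquiv, ?_⟩
    ext v
    rfl
  have hFa : ContDiffAt ℝ 1 F (x₀, y₀) := hF.contDiffAt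
  refine ⟨hFa.implicitFunction one_ne_zero hinv, hFa.implicitFunction_apply_self one_ne_zero hinv,
    hFa.contDiffAt_implicitFunction one_ne_zero hinv, ?_⟩
  have := hFa.eventually_apply_eq_iff_implicitFunction one_ne_zero hinv
  rwa [h0] at this

/-- The derivative of a strongly monotone mapping is coercive. -/
theorem le_inner_fderiv_of_strongly_monotone {V : Type*} [NormedAddCommGroup V]
    [InnerProductSpace ℝ V] {T : V → V} {T' : V →L[ℝ] V} {y : V} {β : ℝ} (hT : HasFDerivAt T T' y)
    (hmono : ∀ y', β * ‖y' - y‖ ^ 2 ≤ inner ℝ (T y' - T y) (y' - y)) (v : V) :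
    β * ‖v‖ ^ 2 ≤ inner ℝ (T' v) v := by
  have hd : HasDerivAt (fun t : ℝ => T (y + t • v)) (T' v) 0 := by
    have h1 : HasDerivAt (fun t : ℝ => y + t • v) v 0 := by
      simpa using ((hasDerivAt_id (0 : ℝ)).smul_const v).const_add y
    have h2 : HasFDerivAt T T' (y + (0 : ℝ) • v) := by simpa using hT
    exact h2.comp_hasDerivAt 0 h1
  have hlim := hd.tendsto_slope_zero_right.inner (𝕜 := ℝ) (tendsto_const_nhds (x := v))
  refine ge_of_tendsto hlim ?_
  filter_upwards [self_mem_nhdsWithin] with t ht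
  have ht' : (0 : ℝ) < t := ht
  have h1 := hmono (y + t • v)
  rw [add_sub_cancel_left, inner_smul_right, norm_smul, mul_pow, Real.norm_eq_abs, sq_abs] at h1
  rw [zero_smul, add_zero, zero_add, inner_smul_left, RCLike.conj_to_real, le_inv_mul_iff₀ ht']
  refine le_of_mul_le_mul_left ?_ ht'
  linarith

theorem exists_hasFDerivAt_toLp {X A B : Type*} [NormedAddCommGroup X] [NormedSpace ℝ X]
    [NormedAddCommGroup A] [NormedSpace ℝ A] [NormedAddCommGroup B] [NormedSpace ℝ B]
    {f₁ : X → A} {f₂ : X → B} {f₁' : X →L[ℝ] A} {f₂' : X →L[ℝ] B} {x : X}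
    (h₁ : HasFDerivAt f₁ f₁' x) (h₂ : HasFDerivAt f₂ f₂' x) :
    ∃ L : X →L[ℝ] WithLp 2 (A × B), HasFDerivAt (fun x => WithLp.toLp 2 (f₁ x, f₂ x)) L x ∧
      ∀ v, L v = WithLp.toLp 2 (f₁' v, f₂' v) :=
  ⟨(WithLp.prodContinuousLinearEquiv 2 ℝ A B).symm.toContinuousLinearMap.comp (f₁'.prod f₂'),
    (WithLp.prodContinuousLinearEquiv 2 ℝ A B).symm.hasFDerivAt.comp x (h₁.prodMk h₂),
    fun _ => rfl⟩

end ImplicitFunction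

/-! ### The reduced problem as a square smooth system. -/

section Reduced

variable {n m s : ℕ} {g : E n → E m → ℝ} {G : E n → E m → E s} {α β : ℝ}

/-- The equation system equivalent to the reduced primal-dual problem. -/
def reducedSystem (g : E n → E m → ℝ) (G : E n → E m → E s) (α β : ℝ) (M : Submodule ℝ (E s))
    (z₀ p₀ : E s) (u : E n × PD m s) : PD m s :=
  WithLp.toLp 2 (lagrGrad g G β u.1 u.2.fst u.2.snd,
    M.starProjection (u.2.snd - p₀) + Mᗮ.starProjection (shifted G α u.1 u.2 - z₀))

theorem contDiff_reducedSystem (hg : ContDiff ℝ 2 fun q : E n × E m => g q.1 q.2)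
    (hG : ContDiff ℝ 2 fun q : E n × E m => G q.1 q.2) (M : Submodule ℝ (E s)) (z₀ p₀ : E s) :
    ContDiff ℝ 1 (reducedSystem g G α β M z₀ p₀) := by
  have hsnd : ContDiff ℝ 1 fun u : E n × PD m s => u.2.snd :=
    (WithLp.sndL 2 ℝ (E m) (E s)).contDiff.comp contDiff_snd
  exact (WithLp.prodContinuousLinearEquiv 2 ℝ (E m) (E s)).symm.contDiff.comp
    ((contDiff_lagrGrad hg hG β).prodMk
      ((M.starProjection.contDiff.comp (hsnd.sub contDiff_const)).add
        (Mᗮ.starProjection.contDiff.comp ((contDiff_shifted hG α).sub contDiff_const))))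

/-- The summands are orthogonal, so they vanish separately. This packs two membership conditions
into one equation in `E s`. -/
theorem starProjection_add_eq_zero_iff (M : Submodule ℝ (E s)) (v w : E s) :
    M.starProjection v + Mᗮ.starProjection w = 0 ↔ v ∈ Mᗮ ∧ w ∈ M := by
  constructor
  · intro h
    have h1 : M.starProjection v ∈ M := M.starProjection_apply_mem v
    have h2 : Mᗮ.starProjection w ∈ Mᗮ := Mᗮ.starProjection_apply_mem w
    have h3 : M.starProjection v = 0 := by
      rw [← inner_self_eq_zero (𝕜 := ℝ)]
      nth_rewrite 2 [eq_neg_of_add_eq_zero_left h]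
      rw [inner_neg_right, Submodule.inner_right_of_mem_orthogonal h1 h2, neg_zero]
    rw [h3, zero_add] at h
    refine ⟨M.starProjection_apply_eq_zero_iff.1 h3, ?_⟩
    rw [← M.orthogonal_orthogonal]
    exact Mᗮ.starProjection_apply_eq_zero_iff.1 h
  · rintro ⟨hv, hw⟩
    rw [M.starProjection_apply_eq_zero_iff.2 hv, Mᗮ.starProjection_apply_eq_zero_iff.2
      (by rwa [M.orthogonal_orthogonal]), add_zero]

theorem reducedSystem_eq_zero_iff {M : Submodule ℝ (E s)} {z₀ p₀ : E s} {u : E n × PD m s} :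
    reducedSystem g G α β M z₀ p₀ u = 0 ↔ lagrGrad g G β u.1 u.2.fst u.2.snd = 0 ∧
      u.2.snd - p₀ ∈ Mᗮ ∧ shifted G α u.1 u.2 - z₀ ∈ M := by
  rw [← starProjection_add_eq_zero_iff]
  constructor
  · intro h
    exact ⟨congrArg WithLp.fst h, congrArg WithLp.snd h⟩
  · rintro ⟨h1, h2⟩
    rw [reducedSystem, h1, h2]
    rfl

/-- Split the derivative into partials: the one in `y` is coercive by strong monotonicity with the
multiplier fixed, the one in `p` is the adjoint of the derivative of `G`. -/
theorem le_inner_fderiv_lagrGrad {x₀ : E n}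
    (hg : Differentiable ℝ (g x₀)) (hG : Differentiable ℝ (G x₀))
    (hgc : ConvexOn ℝ Set.univ (g x₀)) (hGc : ∀ i, ConvexOn ℝ Set.univ fun y => G x₀ y i)
    {q₀ : PD m s} (hp₀ : ∀ i, 0 ≤ q₀.snd i) {N' : PD m s →L[ℝ] E m}
    (hN : HasFDerivAt (fun q : PD m s => lagrGrad g G β x₀ q.fst q.snd) N' q₀) (v : PD m s) :
    β * ‖v.fst‖ ^ 2 + inner ℝ v.snd (fderiv ℝ (G x₀) q₀.fst v.fst) ≤ inner ℝ (N' v) v.fst := by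
  have hN' : HasFDerivAt (fun q : PD m s => lagrGrad g G β x₀ q.fst q.snd) N'
      (WithLp.toLp 2 (q₀.fst, q₀.snd)) := hN
  have hsplit : v = WithLp.toLp 2 (v.fst, 0) + WithLp.toLp 2 (0, v.snd) := by
    rw [← WithLp.toLp_add, Prod.mk_add_mk, add_zero, zero_add]; rfl
  have hy : β * ‖v.fst‖ ^ 2 ≤ inner ℝ (N' (WithLp.toLp 2 (v.fst, 0))) v.fst := by
    obtain ⟨L, hL, hLv⟩ := exists_hasFDerivAt_toLp (hasFDerivAt_id q₀.fst)
      (hasFDerivAt_const q₀.snd q₀.fst)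
    have hT : HasFDerivAt (fun y : E m => lagrGrad g G β x₀ y q₀.snd) (N'.comp L) q₀.fst :=
      HasFDerivAt.comp (g := fun q : PD m s => lagrGrad g G β x₀ q.fst q.snd)
        (f := fun y : E m => WithLp.toLp 2 (y, q₀.snd)) q₀.fst hN' hL
    have e : N' (WithLp.toLp 2 (v.fst, 0)) = (N'.comp L) v.fst :=
      congrArg N' (hLv v.fst).symm
    rw [e]
    refine le_inner_fderiv_of_strongly_monotone hT (fun y' => ?_) v.fst
    have := lagrGrad_strongly_monotone (β := β) hg hG hgc hGc hp₀ hp₀ y' q₀.fst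
    rwa [sub_self q₀.snd, inner_zero_right, sub_zero] at this
  have hp : N' (WithLp.toLp 2 (0, v.snd))
      = ContinuousLinearMap.adjoint (fderiv ℝ (G x₀) q₀.fst) v.snd := by
    obtain ⟨L, hL, hLv⟩ := exists_hasFDerivAt_toLp (hasFDerivAt_const q₀.fst q₀.snd)
      (hasFDerivAt_id q₀.snd)
    have hT : HasFDerivAt (fun p : E s => lagrGrad g G β x₀ q₀.fst p) (N'.comp L) q₀.snd :=
      HasFDerivAt.comp (g := fun q : PD m s => lagrGrad g G β x₀ q.fst q.snd)
        (f := fun p : E s => WithLp.toLp 2 (q₀.fst, p)) q₀.snd hN' hL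
    have e : N' (WithLp.toLp 2 (0, v.snd)) = (N'.comp L) v.snd :=
      congrArg N' (hLv v.snd).symm
    rw [e]
    have hT' : HasFDerivAt (fun p : E s => lagrGrad g G β x₀ q₀.fst p)
        (ContinuousLinearMap.adjoint (fderiv ℝ (G x₀) q₀.fst)) q₀.snd :=
      ((ContinuousLinearMap.adjoint (fderiv ℝ (G x₀) q₀.fst)).hasFDerivAt.const_add _).add_const _
    exact congrArg (fun l => l v.snd) (hT.unique hT')
  conv_rhs => rw [hsplit, map_add, hp, ← hsplit]
  rw [inner_add_left, ContinuousLinearMap.adjoint_inner_left]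
  linarith

theorem exists_hasFDerivAt_reducedSystem {M : Submodule ℝ (E s)} {z₀ p₀ : E s} {x₀ : E n}
    {q₀ : PD m s} (hG : Differentiable ℝ (G x₀)) {N' : PD m s →L[ℝ] E m}
    (hN : HasFDerivAt (fun q : PD m s => lagrGrad g G β x₀ q.fst q.snd) N' q₀) :
    ∃ L : PD m s →L[ℝ] PD m s, HasFDerivAt (fun q : PD m s => reducedSystem g G α β M z₀ p₀ (x₀, q)) L q₀ ∧
      ∀ v, L v = WithLp.toLp 2 (N' v, M.starProjection v.snd
        + Mᗮ.starProjection (fderiv ℝ (G x₀) q₀.fst v.fst - α • v.snd)) := by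
  have hfst : HasFDerivAt (fun q : PD m s => q.fst) (WithLp.fstL 2 ℝ (E m) (E s)) q₀ :=
    (WithLp.fstL 2 ℝ (E m) (E s)).hasFDerivAt
  have hsnd : HasFDerivAt (fun q : PD m s => q.snd) (WithLp.sndL 2 ℝ (E m) (E s)) q₀ :=
    (WithLp.sndL 2 ℝ (E m) (E s)).hasFDerivAt
  have hZ : HasFDerivAt (fun q : PD m s => shifted G α x₀ q)
      ((fderiv ℝ (G x₀) q₀.fst).comp (WithLp.fstL 2 ℝ (E m) (E s))
        - α • WithLp.sndL 2 ℝ (E m) (E s)) q₀ :=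
    ((hG q₀.fst).hasFDerivAt.comp q₀ hfst).sub (hsnd.const_smul α)
  have h1 := M.starProjection.hasFDerivAt.comp q₀ (hsnd.sub_const p₀)
  have h2 := Mᗮ.starProjection.hasFDerivAt.comp q₀ (hZ.sub_const z₀)
  exact exists_hasFDerivAt_toLp hN (h1.add h2)

theorem exists_injective_hasFDerivAt_reducedSystem (hα : 0 < α) (hβ : 0 < β)
    (hg : ContDiff ℝ 2 fun q : E n × E m => g q.1 q.2)
    (hG : ContDiff ℝ 2 fun q : E n × E m => G q.1 q.2)
    (hgc : ∀ x, ConvexOn ℝ Set.univ (g x)) (hGc : ∀ i x, ConvexOn ℝ Set.univ fun y => G x y i)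
    {M : Submodule ℝ (E s)} {z₀ p₀ : E s} {x₀ : E n} {q₀ : PD m s} (hp₀ : ∀ i, 0 ≤ q₀.snd i) :
    ∃ L : PD m s →L[ℝ] PD m s,
      HasFDerivAt (fun q : PD m s => reducedSystem g G α β M z₀ p₀ (x₀, q)) L q₀ ∧
        ∀ v, L v = 0 → v = 0 := by
  obtain ⟨N', hN⟩ : ∃ N', HasFDerivAt (fun q : PD m s => lagrGrad g G β x₀ q.fst q.snd) N' q₀ :=
    ⟨_, (((contDiff_lagrGrad hg hG β).comp (f := fun q : PD m s => (x₀, q))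
      (contDiff_const.prodMk contDiff_id)).differentiable one_ne_zero q₀).hasFDerivAt⟩
  obtain ⟨L, hL, hLv⟩ := exists_hasFDerivAt_reducedSystem (α := α) (M := M) (z₀ := z₀)
    (p₀ := p₀) (differentiable_section_vec hG x₀) hN
  refine ⟨L, hL, fun v hv => ?_⟩
  have h0 : (0 : PD m s) = WithLp.toLp 2 (N' v, M.starProjection v.snd
      + Mᗮ.starProjection (fderiv ℝ (G x₀) q₀.fst v.fst - α • v.snd)) :=
    hv.symm.trans (hLv v)
  have e1 : N' v = 0 := (congrArg WithLp.fst h0).symm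
  have e2 : M.starProjection v.snd
      + Mᗮ.starProjection (fderiv ℝ (G x₀) q₀.fst v.fst - α • v.snd) = 0 :=
    (congrArg WithLp.snd h0).symm
  rw [starProjection_add_eq_zero_iff] at e2
  -- Orthogonality turns the mixed term of `hle` into `α‖v.snd‖²`, so both squares vanish.
  have hin := Submodule.inner_left_of_mem_orthogonal e2.2 e2.1
  rw [inner_sub_right, inner_smul_right, real_inner_self_eq_norm_sq] at hin
  have hle := le_inner_fderiv_lagrGrad (differentiable_section hg x₀)
    (differentiable_section_vec hG x₀) (hgc x₀) (fun i => hGc i x₀) hp₀ hN v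
  rw [e1, inner_zero_left] at hle
  have a1 : 0 ≤ β * ‖v.fst‖ ^ 2 := by positivity
  have a2 : 0 ≤ α * ‖v.snd‖ ^ 2 := by positivity
  have z1 : β * ‖v.fst‖ ^ 2 = 0 := by linarith
  have z2 : α * ‖v.snd‖ ^ 2 = 0 := by linarith
  have f1 : v.fst = 0 := by simpa [hβ.ne'] using z1
  have f2 : v.snd = 0 := by simpa [hα.ne'] using z2
  change WithLp.toLp 2 (v.fst, v.snd) = WithLp.toLp 2 (0, 0)
  rw [f1, f2]

/-- The reduced problem locally has a unique solution, which depends on the parameter in a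
continuously differentiable way. -/
theorem exists_reduced_selection (hα : 0 < α) (hβ : 0 < β)
    (hg : ContDiff ℝ 2 fun q : E n × E m => g q.1 q.2)
    (hG : ContDiff ℝ 2 fun q : E n × E m => G q.1 q.2)
    (hgc : ∀ x, ConvexOn ℝ Set.univ (g x)) (hGc : ∀ i x, ConvexOn ℝ Set.univ fun y => G x y i)
    {I J : Type} [Fintype I] [Fintype J] [Nonempty J] {D : PolyData s I J} {x₀ : E n} {q₀ : PD m s}
    (hp₀ : ∀ i, 0 ≤ q₀.snd i) (hz₀ : shifted G α x₀ q₀ ∈ D.constraintSet)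
    (hgrad : lagrGrad g G β x₀ q₀.fst q₀.snd = 0)
    {σ : J → ℝ} {τ : I → ℝ} (hr : D.Represents (shifted G α x₀ q₀) q₀.snd σ τ)
    {I' : Set I} {J' : Set J} (hadm : D.Admissible (shifted G α x₀ q₀) σ τ I' J') :
    ∃ φ : E n → PD m s, φ x₀ = q₀ ∧ ContDiffAt ℝ 1 φ x₀ ∧
      ∀ᶠ u in 𝓝 (x₀, q₀), ∀ j₀ ∈ J', u.2 ∈ solSet g G (D.reduced I' J' j₀) α β u.1 ↔ φ u.1 = u.2 := by
  obtain ⟨L, hL, hLinj⟩ := exists_injective_hasFDerivAt_reducedSystem (z₀ := shifted G α x₀ q₀)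
    (p₀ := q₀.snd) (M := D.direction I' J') hα hβ hg hG hgc hGc (x₀ := x₀) hp₀
  obtain ⟨φ, h1, h2, h3⟩ := exists_implicitFunction
    (contDiff_reducedSystem (α := α) (β := β) hg hG (D.direction I' J') (shifted G α x₀ q₀) q₀.snd)
    (x₀ := x₀) (y₀ := q₀) (reducedSystem_eq_zero_iff.2 ⟨hgrad, by simp, by simp⟩) hL hLinj
  refine ⟨φ, h1, h2, h3.mono fun u hu j₀ hj₀ => ?_⟩
  rw [← hu, reducedSystem_eq_zero_iff, mem_solSet_iff,
    PolyData.mem_subdifferential_conjugate_reduced_iff hj₀ (hadm.mem_face hz₀ hj₀)]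
  -- Basing the system at `q₀.snd` instead of `D.a j₀` makes it independent of `j₀`; the two differ
  -- by an element of the orthogonal complement.
  have e : u.2.snd - D.a j₀ = (u.2.snd - q₀.snd) + (q₀.snd - D.a j₀) := by abel
  rw [e, Submodule.add_mem_iff_left _ (hr.sub_mem_orthogonal hadm hj₀)]

/-- The current point `shifted G α x q` lies on the face cut out by its own active indices and
serves as base point. -/
theorem mem_solSet_reduced_active {I J : Type} [Finite I] [Finite J] [Nonempty J]
    {D : PolyData s I J} {x : E n} {q : PD m s} (hgrad : lagrGrad g G β x q.fst q.snd = 0)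
    (hq : q.snd ∈ subdifferential D.toFun (shifted G α x q)) {j₀ : J}
    (hj₀ : j₀ ∈ D.activeJ (shifted G α x q)) :
    q ∈ solSet g G (D.reduced (D.activeI (shifted G α x q)) (D.activeJ (shifted G α x q)) j₀)
      α β x := by
  have hz := D.mem_constraintSet_of_mem_subdifferential hq
  rw [mem_solSet_iff, PolyData.mem_subdifferential_conjugate_reduced_iff hj₀
    (z₀ := shifted G α x q)]
  · refine ⟨hgrad, PolyData.sub_mem_orthogonal_of_mem_normalSet hj₀
      ((D.mem_subdifferential_iff_mem_normalSet hz).1 hq), by simp⟩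
  · refine ⟨fun j hj => ?_, fun i hi => hi⟩
    change D.piece j _ = D.piece j₀ _
    rw [(D.mem_activeJ_iff hz).1 hj, (D.mem_activeJ_iff hz).1 hj₀]

end Reduced

/-! ### Admissibility of nearby active sets and the selections. -/

section Selections

variable {n m s : ℕ} {g : E n → E m → ℝ} {G : E n → E m → E s} {α β : ℝ}

/-- Near `x₀`, the active index sets at the solution are admissible. -/
theorem eventually_admissible (hG : ContDiff ℝ 2 fun q : E n × E m => G q.1 q.2)
    {I J : Type} [Fintype I] [Fintype J] [Nonempty J] {D : PolyData s I J}
    {S : E n → PD m s} (hSc : Continuous S)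
    (hS : ∀ x, (S x).snd ∈ subdifferential D.toFun (shifted G α x (S x))) {x₀ : E n}
    {σ : J → ℝ} {τ : I → ℝ} (hr : D.Represents (shifted G α x₀ (S x₀)) (S x₀).snd σ τ) :
    ∀ᶠ x in 𝓝 x₀, D.Admissible (shifted G α x₀ (S x₀)) σ τ
      (D.activeI (shifted G α x (S x))) (D.activeJ (shifted G α x (S x))) := by
  have hmem : ∀ x, shifted G α x (S x) ∈ D.constraintSet := fun x =>
    D.mem_constraintSet_of_mem_subdifferential (hS x)
  have hzc : Continuous fun x => shifted G α x (S x) :=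
    (contDiff_shifted hG α).continuous.comp (f := fun x => (x, S x)) (continuous_id.prodMk hSc)
  have hpc : Continuous fun x => (S x).snd :=
    (WithLp.sndL 2 ℝ (E m) (E s)).continuous.comp hSc
  -- There are finitely many closed sets `normalSet I' J'`; near `x₀` the multiplier avoids those
  -- not containing its limit.
  have hnormal : ∀ᶠ x in 𝓝 x₀, ∀ (I' : Set I) (J' : Set J),
      (S x).snd ∈ D.normalSet I' J' → (S x₀).snd ∈ D.normalSet I' J' := by
    simp only [Filter.eventually_all]
    intro I' J'
    by_cases hp : (S x₀).snd ∈ D.normalSet I' J'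
    · exact Filter.Eventually.of_forall fun _ _ => hp
    · filter_upwards [hpc.continuousAt.eventually
        ((D.isClosed_normalSet I' J').isOpen_compl.eventually_mem hp)] with x hx hx'
      exact absurd hx' hx
  filter_upwards [hnormal, hzc.continuousAt.eventually (D.eventually_activeI_subset _),
    hzc.continuousAt.eventually (D.eventually_activeJ_subset (hmem x₀))] with x h1 h2 h3
  have h4 := h1 _ _ ((D.mem_subdifferential_iff_mem_normalSet (hmem x)).1 (hS x))
  -- The multiplier at `x₀` is now a subgradient at the nearby point, so `support_subset` applies.
  rw [← D.mem_subdifferential_iff_mem_normalSet (hmem x)] at h4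
  obtain ⟨h5, h6⟩ := hr.support_subset D (hmem x₀) h4
  exact ⟨h5, h2, h6, h3 (hmem x)⟩

theorem exists_selections (hα : 0 < α) (hβ : 0 < β)
    (hg : ContDiff ℝ 2 fun q : E n × E m => g q.1 q.2)
    (hG : ContDiff ℝ 2 fun q : E n × E m => G q.1 q.2)
    (hgc : ∀ x, ConvexOn ℝ Set.univ (g x)) (hGc : ∀ i x, ConvexOn ℝ Set.univ fun y => G x y i)
    {I J : Type} [Fintype I] [Fintype J] [Nonempty J] {D : PolyData s I J}
    (hm : IsNondecreasing D.toFun) {S : E n → PD m s} (hSc : Continuous S)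
    (hgrad : ∀ x, lagrGrad g G β x (S x).fst (S x).snd = 0)
    (hS : ∀ x, (S x).snd ∈ subdifferential D.toFun (shifted G α x (S x))) (x₀ : E n)
    {σ : J → ℝ} {τ : I → ℝ} (hr : D.Represents (shifted G α x₀ (S x₀)) (S x₀).snd σ τ) :
    ∃ (U : Set (E n)) (V : Set (PD m s)) (φ : Set I → Set J → E n → PD m s),
      IsOpen U ∧ x₀ ∈ U ∧ IsOpen V ∧ S x₀ ∈ V ∧
      (∀ I' J', D.Admissible (shifted G α x₀ (S x₀)) σ τ I' J' →
        ContDiffOn ℝ 1 (φ I' J') U ∧ φ I' J' x₀ = S x₀ ∧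
        ∀ j₀ ∈ J', ∀ x ∈ U, solSet g G (D.reduced I' J' j₀) α β x ∩ V = {φ I' J' x}) ∧
      ∀ x ∈ U,
        D.Admissible (shifted G α x₀ (S x₀)) σ τ
          (D.activeI (shifted G α x (S x))) (D.activeJ (shifted G α x (S x))) ∧
        S x = φ (D.activeI (shifted G α x (S x))) (D.activeJ (shifted G α x (S x))) x := by
  have hsel : ∀ (I' : Set I) (J' : Set J), ∃ φ : E n → PD m s,
      D.Admissible (shifted G α x₀ (S x₀)) σ τ I' J' →
        φ x₀ = S x₀ ∧ ContDiffAt ℝ 1 φ x₀ ∧ ∀ᶠ u in 𝓝 (x₀, S x₀), ∀ j₀ ∈ J',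
          u.2 ∈ solSet g G (D.reduced I' J' j₀) α β u.1 ↔ φ u.1 = u.2 := by
    intro I' J'
    by_cases hadm : D.Admissible (shifted G α x₀ (S x₀)) σ τ I' J'
    · obtain ⟨φ, hφ⟩ := exists_reduced_selection hα hβ hg hG hgc hGc
        (nonneg_of_mem_subdifferential hm (hS x₀))
        (D.mem_constraintSet_of_mem_subdifferential (hS x₀)) (hgrad x₀) hr hadm
      exact ⟨φ, fun _ => hφ⟩
    · exact ⟨fun _ => 0, fun h => absurd h hadm⟩
  choose φ hφ using hsel
  have hiff : ∀ᶠ u in 𝓝 (x₀, S x₀), ∀ I' J',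
      D.Admissible (shifted G α x₀ (S x₀)) σ τ I' J' → ∀ j₀ ∈ J',
        (u.2 ∈ solSet g G (D.reduced I' J' j₀) α β u.1 ↔ φ I' J' u.1 = u.2) := by
    exact Filter.eventually_all.2 fun I' => Filter.eventually_all.2 fun J' =>
      Filter.eventually_imp_distrib_left.2 fun hadm => (hφ I' J' hadm).2.2
  obtain ⟨U₀, V, hU₀, hxU₀, hV, hSV, hUV⟩ := mem_nhds_prod_iff'.1 hiff
  have hsmooth : ∀ᶠ x in 𝓝 x₀, ∀ I' J', D.Admissible (shifted G α x₀ (S x₀)) σ τ I' J' →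
      ContDiffAt ℝ 1 (φ I' J') x ∧ φ I' J' x ∈ V := by
    simp only [Filter.eventually_all]
    intro I' J' hadm
    obtain ⟨h1, h2, -⟩ := hφ I' J' hadm
    refine (h2.eventually (by simp)).and (h2.continuousAt.eventually ?_)
    rw [h1]
    exact hV.eventually_mem hSV
  -- `V` is fixed first; `U` is then shrunk so that `S` and all admissible selections stay in `V`.
  obtain ⟨U, hU, hUo, hxU⟩ := eventually_nhds_iff.1 (((hU₀.eventually_mem hxU₀).and hsmooth).and
    ((hSc.continuousAt.eventually (hV.eventually_mem hSV)).and
      (eventually_admissible hG hSc hS hr)))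
  refine ⟨U, V, φ, hUo, hxU, hV, hSV, fun I' J' hadm => ⟨fun x hx =>
    ((hU x hx).1.2 I' J' hadm).1.contDiffWithinAt, (hφ I' J' hadm).1, fun j₀ hj₀ x hx => ?_⟩,
    fun x hx => ⟨(hU x hx).2.2, ?_⟩⟩
  · obtain ⟨⟨hxU₀, h2⟩, -⟩ := hU x hx
    have hVx := (h2 I' J' hadm).2
    refine Set.eq_singleton_iff_unique_mem.2 ⟨⟨?_, hVx⟩, fun q hq => ?_⟩
    · exact (hUV (Set.mk_mem_prod hxU₀ hVx) I' J' hadm j₀ hj₀).2 rfl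
    · exact ((hUV (Set.mk_mem_prod hxU₀ hq.2) I' J' hadm j₀ hj₀).1 hq.1).symm
  · obtain ⟨⟨hxU₀, -⟩, hSx, hadm⟩ := hU x hx
    obtain ⟨j₀, hj⟩ := D.exists_piece_eq_maxPiece (shifted G α x (S x))
    have hj₀ := (D.mem_activeJ_iff (D.mem_constraintSet_of_mem_subdifferential (hS x))).2 hj
    exact ((hUV (Set.mk_mem_prod hxU₀ hSx) _ _ hadm j₀ hj₀).1
      (mem_solSet_reduced_active (hgrad x) (hS x) hj₀)).symm

end Selections

end Bilevel

end

theorem theorem4 {n m s : ℕ}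
    (g : Bilevel.E n → Bilevel.E m → ℝ) (G : Bilevel.E n → Bilevel.E m → Bilevel.E s)
    (h : Bilevel.E s → EReal)
    (hg : ContDiff ℝ 2 fun q : Bilevel.E n × Bilevel.E m => g q.1 q.2)
    (hG : ∀ i, ContDiff ℝ 2 fun q : Bilevel.E n × Bilevel.E m => G q.1 q.2 i)
    (hg_convex : ∀ x, ConvexOn ℝ Set.univ (g x))
    (hG_convex : ∀ i x, ConvexOn ℝ Set.univ fun y => G x y i)
    (hh_proper : Bilevel.IsProper h) (hh_poly : Bilevel.IsEpiPolyhedral h)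
    (hh_mono : Bilevel.IsNondecreasing h)
    (α β : ℝ) (hα : 0 < α) (hβ : 0 < β) :
    ∃ S : Bilevel.E n → Bilevel.PD m s,
      -- `S` is the primal-dual solution mapping, and its first component is the primal one
      (∀ x, Bilevel.solSet g G h α β x = {S x}) ∧
      (∀ x, Bilevel.regArgmin g G h α β x = {(S x).fst}) ∧
      Bilevel.IsPC1 S ∧
      -- the selections, for any polyhedral description `D` of `h`
      ∀ (I J : Type) [Fintype I] [Fintype J] (D : Bilevel.PolyData s I J), h = D.toFun →
        ∀ x₀ : Bilevel.E n,
          (∃ σ τ, D.Represents (Bilevel.shifted G α x₀ (S x₀)) (S x₀).snd σ τ) ∧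
          ∀ σ τ, D.Represents (Bilevel.shifted G α x₀ (S x₀)) (S x₀).snd σ τ →
            ∃ (U : Set (Bilevel.E n)) (V : Set (Bilevel.PD m s))
              (φ : Set I → Set J → Bilevel.E n → Bilevel.PD m s),
              IsOpen U ∧ x₀ ∈ U ∧ IsOpen V ∧ S x₀ ∈ V ∧
              (∀ I' J', D.Admissible (Bilevel.shifted G α x₀ (S x₀)) σ τ I' J' →
                ContDiffOn ℝ 1 (φ I' J') U ∧ φ I' J' x₀ = S x₀ ∧
                ∀ j₀ ∈ J', ∀ x ∈ U,
                  Bilevel.solSet g G (D.reduced I' J' j₀) α β x ∩ V = {φ I' J' x}) ∧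
              ∀ x ∈ U,
                D.Admissible (Bilevel.shifted G α x₀ (S x₀)) σ τ
                  (D.activeI (Bilevel.shifted G α x (S x)))
                  (D.activeJ (Bilevel.shifted G α x (S x))) ∧
                S x = φ (D.activeI (Bilevel.shifted G α x (S x)))
                  (D.activeJ (Bilevel.shifted G α x (S x))) x := by
  have hG' := Bilevel.contDiff_of_coord hG
  choose S hS hmin hsub using fun x => Bilevel.exists_solution hα hβ hh_proper hh_poly hh_mono
    (Bilevel.differentiable_section hg x) (Bilevel.differentiable_section_vec hG' x)
    (hg_convex x) (fun i => hG_convex i x)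
  have hmem : ∀ x, S x ∈ Bilevel.solSet g G h α β x := fun x => by
    rw [hS x]; exact Set.mem_singleton _
  have hSc : Continuous S := Bilevel.continuous_of_mem_solSet hα hβ hh_proper hh_mono hg hG'
    hg_convex hG_convex hmem
  have hgrad := fun x => (Bilevel.mem_solSet_iff.1 (hmem x)).1
  refine ⟨S, hS, hmin, ⟨hSc, fun x₀ => ?_⟩, fun I J _ _ D hD x₀ => ?_⟩
  · obtain ⟨I, J, _, _, D, rfl⟩ := Bilevel.exists_polyData hh_proper hh_poly
    have := D.nonempty_of_isProper hh_proper
    obtain ⟨σ, τ, hr⟩ := D.exists_represents (hsub x₀)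
    obtain ⟨U, V, φ, hU, hxU, -, -, hφ, hsel⟩ := Bilevel.exists_selections hα hβ hg hG' hg_convex
      hG_convex hh_mono hSc hgrad hsub x₀ hr
    -- Only admissible pairs are enumerated, since smoothness is known for those alone.
    let A := {P : Set I × Set J //
      D.Admissible (Bilevel.shifted G α x₀ (S x₀)) σ τ P.1 P.2}
    obtain ⟨k, ⟨e⟩⟩ := Finite.exists_equiv_fin A
    refine ⟨U, hU, hxU, k, fun l => φ (e.symm l).1.1 (e.symm l).1.2,
      fun l => (hφ _ _ (e.symm l).2).1, fun x hx => ?_⟩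
    let P : A := ⟨(D.activeI (Bilevel.shifted G α x (S x)),
      D.activeJ (Bilevel.shifted G α x (S x))), (hsel x hx).1⟩
    refine ⟨e P, (hsel x hx).2.trans ?_⟩
    simp only [Equiv.symm_apply_apply, P]
  · subst hD
    have := D.nonempty_of_isProper hh_proper
    exact ⟨D.exists_represents (hsub x₀), fun σ τ hr => Bilevel.exists_selections hα hβ hg hG'
      hg_convex hG_convex hh_mono hSc hgrad hsub x₀ hr⟩
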